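/- Let $d\ge 1$ and $C>0$. Let $\Gamma_0=\bigsqcup_{n\ge 0}\Gamma^{(n)}$ be the space of finite subsets of $\mathbb R^d$, with its usual topology (disjoint union of the quotients of the spaces of $n$-tuples of distinct points) and Borel $\sigma$-algebra, and let $$\Gamma_0^2=\{(\eta^+,\eta^-)\in\Gamma_0\times\Gamma_0:\ \eta^+\cap\eta^-=\emptyset\}.$$ For $z>0$ let $\lambda_z=\sum_{n\ge0}\frac{z^n}{n!}m^{(n)}$ be the Lebesgue–Poisson measure on $\Gamma_0$, where $m^{(n)}$ is the image of $dx_1\cdots dx_n$ under $(x_1,\dots,x_n)\mapsto\{x_1,\dots,x_n\}$, let $\lambda_z^2=\lambda_z\otimes\lambda_z$ on $\Gamma_0^2$, $\lambda^2=\lambda_1^2$, and $\mathcal L_C=L^1(\Gamma_0^2,\lambda_C^2)$, so that $\|G\|_{\mathcal L_C}=\int_{\Gamma_0^2}|G(\eta^+,\eta^-)|\,C^{|\eta^+|+|\eta^-|}\,d\lambda^2(\eta^+,\eta^-)$. Let $c_i^{\pm}(x,y,\gamma^+,\gamma^-)\ge 0$, $i=1,2$, be measurable functions on $\mathbb R^d\times\mathbb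 R^d\times\Gamma_0^2$ such that $c_i^\pm(\cdot,\cdot,\gamma^+,\gamma^-)\in L^1_{\rm loc}(\mathbb R^d\times\mathbb R^d)$ for every $(\gamma^+,\gamma^-)\in\Gamma_0^2$, and set $$C_i^\pm(x,y,\xi^+,\xi^-,\eta^+,\eta^-)=\sum_{\zeta^+\subset\eta^+}\sum_{\zeta^-\subset\eta^-}(-1)^{|\eta^+\setminus\zeta^+|+|\eta^-\setminus\zeta^-|}\,c_i^\pm(x,y,\zeta^+\cup\xi^+,\zeta^-\cup\xi^-).$$ Let $N_1,N_2:\Gamma_0^2\to\mathbb R$ be measurable functions, integrable with respect to $\lambda^2$ over $\{(\eta^+,\eta^-)\in\Gamma_0^2:\ |\eta^+|=n,\ |\eta^-|=m,\ \eta^+\cup\eta^-\subset\Lambda\}$ for all $n,m\in\mathbb N=\{1,2,\dots\}$ and all bounded Borel $\Lambda\subset\mathbb R^d$, such that for $\lambda^2$-a.a. $(\eta^+,\eta^-)$ $$\begin{aligned}&\sum_{x\in\eta^+}\Bigl(\Bigl\|\int_{\mathbb R^d}dy\,|C_1^+(x,y,\eta^+\setminus x,\eta^-,\cdot,\cdot)|\Bigr\|_{\mathcal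 L_C}+\Bigl\|\int_{\mathbb R^d}dy\,|C_1^+(y,x,\eta^+\setminus x,\eta^-,\cdot,\cdot)|\Bigr\|_{\mathcal L_C}\Bigr)\\&+\sum_{y\in\eta^-}\Bigl(\Bigl\|\int_{\mathbb R^d}dx\,|C_1^-(x,y,\eta^+,\eta^-\setminus y,\cdot,\cdot)|\Bigr\|_{\mathcal L_C}+\Bigl\|\int_{\mathbb R^d}dx\,|C_1^-(y,x,\eta^+,\eta^-\setminus y,\cdot,\cdot)|\Bigr\|_{\mathcal L_C}\Bigr)\le N_1(\eta^+,\eta^-)\end{aligned}$$ and $$\begin{aligned}&\sum_{x\in\eta^+}\Bigl(\Bigl\|\int_{\mathbb R^d}dy\,|C_2^+(x,y,\eta^+\setminus x,\eta^-,\cdot,\cdot)|\Bigr\|_{\mathcal L_C}+\Bigl\|\int_{\mathbb R^d}dy\,|C_2^-(x,y,\eta^+\setminus x,\eta^-,\cdot,\cdot)|\Bigr\|_{\mathcal L_C}\Bigr)\\&+\sum_{y\in\eta^-}\Bigl(\Bigl\|\int_{\mathbb R^d}dx\,|C_2^+(x,y,\eta^+,\eta^-\setminus y,\cdot,\cdot)|\Bigr\|_{\mathcal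 L_C}+\Bigl\|\int_{\mathbb R^d}dx\,|C_2^-(x,y,\eta^+,\eta^-\setminus y,\cdot,\cdot)|\Bigr\|_{\mathcal L_C}\Bigr)\le N_2(\eta^+,\eta^-).\end{aligned}$$ Then for each $i=1,2$ there is a densely defined linear operator $\hat L_i$ in $\mathcal L_C$ with domain $\mathcal D_i=\{G\in\mathcal L_C:\ N_iG\in\mathcal L_C\}$, which satisfies $\|\hat L_iG\|_{\mathcal L_C}\le\|N_iG\|_{\mathcal L_C}$ for $G\in\mathcal D_i$ and is given, for $\lambda^2$-a.a. $(\eta^+,\eta^-)\in\Gamma_0^2$ and whichever representative of $G\in\mathcal D_i$ is used, by $$\begin{aligned}(\hat L_1G)(\eta^+,\eta^-)=&\sum_{\substack{\xi^+\subset\eta^+\\ \xi^-\subset\eta^-}}\sum_{x\in\xi^+}\int_{\mathbb R^d}dx'\,\bigl(G(\xi^+\setminus x\cup x',\xi^-)-G(\xi^+,\xi^-)\bigr)\,C_1^+(x,x',\xi^+\setminus x,\xi^-,\eta^+\setminus\xi^+,\eta^-\setminus\xi^-)\\&+\sum_{\substack{\xi^+\subset\eta^+\\ \xi^-\subset\eta^-}}\sum_{y\in\xi^-}\int_{\mathbb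 R^d}dy'\,\bigl(G(\xi^+,\xi^-\setminus y\cup y')-G(\xi^+,\xi^-)\bigr)\,C_1^-(y,y',\xi^+,\xi^-\setminus y,\eta^+\setminus\xi^+,\eta^-\setminus\xi^-),\\(\hat L_2G)(\eta^+,\eta^-)=&\sum_{\substack{\xi^+\subset\eta^+\\ \xi^-\subset\eta^-}}\sum_{x\in\xi^+}\int_{\mathbb R^d}dy\,\bigl(G(\xi^+\setminus x,\xi^-\cup y)-G(\xi^+,\xi^-)\bigr)\,C_2^+(x,y,\xi^+\setminus x,\xi^-,\eta^+\setminus\xi^+,\eta^-\setminus\xi^-)\\&+\sum_{\substack{\xi^+\subset\eta^+\\ \xi^-\subset\eta^-}}\sum_{y\in\xi^-}\int_{\mathbb R^d}dx\,\bigl(G(\xi^+\cup x,\xi^-\setminus y)-G(\xi^+,\xi^-)\bigr)\,C_2^-(x,y,\xi^+,\xi^-\setminus y,\eta^+\setminus\xi^+,\eta^-\setminus\xi^-),\end{aligned}$$ where, for $\lambda^2$-a.a. $(\eta^+,\eta^-)$, all the integrals on the right-hand side converge absolutely. -/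

import Mathlib

open MeasureTheory Set
open scoped ENNReal

noncomputable section

/-- The one-particle space `ℝ^d`. -/
abbrev Site (d : ℕ) : Type := EuclideanSpace ℝ (Fin d)

/-- The space `Γ₀` of finite configurations, that is, of finite subsets of `ℝ^d`. (A structure,
so that it carries the topology and `σ`-algebra below and not the instances on `Finset`.) -/
@[ext]
structure FinConf (d : ℕ) where
  /-- the set of points of the configuration -/
  pts : Finset (Site d)

/-- Ordered `n`-tuples of pairwise distinct points of `ℝ^d`. -/
abbrev DistinctTuple (d n : ℕ) : Type := {v : Fin n → Site d // Function.Injective v}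

/-- The symmetrization map `(x₁, …, xₙ) ↦ {x₁, …, xₙ}`. -/
def confOfTuple (d n : ℕ) (v : DistinctTuple d n) : FinConf d :=
  ⟨Finset.univ.map ⟨v.1, v.2⟩⟩

/-- The topology of the disjoint union of the spaces `Γ⁽ⁿ⁾` of `n`-point configurations, each of
them carrying the quotient topology of the space of `n`-tuples of distinct points. -/
instance finConfTopology (d : ℕ) : TopologicalSpace (FinConf d) :=
  ⨆ n : ℕ, TopologicalSpace.coinduced (confOfTuple d n) inferInstance

/-- The Borel `σ`-algebra of `Γ₀`. -/
instance finConfMeasurableSpace (d : ℕ) : MeasurableSpace (FinConf d) :=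
  borel (FinConf d)

instance finConfBorelSpace (d : ℕ) : BorelSpace (FinConf d) := ⟨rfl⟩

/-- The space `Γ₀²` of finite two-component configurations: pairs of disjoint finite
configurations. It carries the topology induced by the product topology and the `σ`-algebra
induced by the product `σ`-algebra (as `Γ₀` is second countable, this is its Borel
`σ`-algebra). -/
abbrev FinConf2 (d : ℕ) : Type := {p : FinConf d × FinConf d // Disjoint p.1.pts p.2.pts}

/-- The measure `m⁽ⁿ⁾` on `Γ₀`: the image of `dx₁ ⋯ dxₙ`, on tuples of distinct points, under
symmetrization. -/
def symLebesgue (d n : ℕ) : Measure (FinConf d) :=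
  Measure.map (confOfTuple d n)
    (Measure.comap (Subtype.val : DistinctTuple d n → (Fin n → Site d)) volume)

/-- The Lebesgue–Poisson measure `λ_z = ∑ₙ (zⁿ / n!) m⁽ⁿ⁾` on `Γ₀`. -/
def lebesguePoisson (d : ℕ) (z : ℝ) : Measure (FinConf d) :=
  Measure.sum fun n : ℕ => ENNReal.ofReal (z ^ n / (n.factorial : ℝ)) • symLebesgue d n

/-- The product measure `λ_z² = λ_z ⊗ λ_z`, as a measure on `Γ₀²`. -/
def lebesguePoisson2 (d : ℕ) (z : ℝ) : Measure (FinConf2 d) :=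
  Measure.comap Subtype.val ((lebesguePoisson d z).prod (lebesguePoisson d z))

/-- The Banach space `𝓛_C = L¹(Γ₀², λ_C²)`. -/
abbrev LSpace (d : ℕ) (C : ℝ) : Type := Lp ℝ 1 (lebesguePoisson2 d C)

open scoped Classical in
/-- The value `G(η⁺, η⁻)` of a function on `Γ₀²`; the value at pairs that are not disjoint, which
are not points of `Γ₀²`, is set to be `0`. -/
def evalAt {d : ℕ} (G : FinConf2 d → ℝ) (ηp ηm : Finset (Site d)) : ℝ :=
  if h : Disjoint ηp ηm then G ⟨(⟨ηp⟩, ⟨ηm⟩), h⟩ else 0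

open scoped Classical in
/-- `(𝒦⁻¹ F(· ∪ ξ⁺, · ∪ ξ⁻))(η⁺, η⁻)
= ∑_{ζ⁺ ⊆ η⁺, ζ⁻ ⊆ η⁻} (-1)^{|η⁺ ∖ ζ⁺| + |η⁻ ∖ ζ⁻|} F(ζ⁺ ∪ ξ⁺, ζ⁻ ∪ ξ⁻)`. -/
def invKShift {d : ℕ} (F : FinConf2 d → ℝ) (ξp ξm ηp ηm : Finset (Site d)) : ℝ :=
  ∑ ζp ∈ ηp.powerset, ∑ ζm ∈ ηm.powerset,
    (-1 : ℝ) ^ ((ηp \ ζp).card + (ηm \ ζm).card) * evalAt F (ζp ∪ ξp) (ζm ∪ ξm)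

/-- The standing assumptions on a hopping rate `c(x, y, γ⁺, γ⁻)`: it is nonnegative, measurable,
and locally integrable in `(x, y)` for every configuration. -/
structure IsHoppingRate {d : ℕ} (c : Site d → Site d → FinConf2 d → ℝ) : Prop where
  nonneg : ∀ x y γ, 0 ≤ c x y γ
  measurable : Measurable fun p : Site d × Site d × FinConf2 d => c p.1 p.2.1 p.2.2
  locallyIntegrable : ∀ γ, LocallyIntegrable (fun p : Site d × Site d => c p.1 p.2 γ) volume

/-- The function `C(x, y, ξ⁺, ξ⁻, η⁺, η⁻) = (𝒦⁻¹ c(x, y, · ∪ ξ⁺, · ∪ ξ⁻))(η⁺, η⁻)`. -/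
def rateK {d : ℕ} (c : Site d → Site d → FinConf2 d → ℝ) (x y : Site d)
    (ξp ξm ηp ηm : Finset (Site d)) : ℝ :=
  invKShift (c x y) ξp ξm ηp ηm

/-- `‖∫ dy |C(x, y, ξ⁺, ξ⁻, ·, ·)|‖_{𝓛_C}`, the second variable `y` being integrated. -/
def normIntSnd {d : ℕ} (C : ℝ) (c : Site d → Site d → FinConf2 d → ℝ) (x : Site d)
    (ξp ξm : Finset (Site d)) : ℝ≥0∞ :=
  eLpNorm (fun ζ : FinConf2 d => ∫⁻ y, ‖rateK c x y ξp ξm ζ.1.1.pts ζ.1.2.pts‖ₑ) 1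
    (lebesguePoisson2 d C)

/-- `‖∫ dx |C(x, y, ξ⁺, ξ⁻, ·, ·)|‖_{𝓛_C}`, the first variable `x` being integrated. -/
def normIntFst {d : ℕ} (C : ℝ) (c : Site d → Site d → FinConf2 d → ℝ) (y : Site d)
    (ξp ξm : Finset (Site d)) : ℝ≥0∞ :=
  eLpNorm (fun ζ : FinConf2 d => ∫⁻ x, ‖rateK c x y ξp ξm ζ.1.1.pts ζ.1.2.pts‖ₑ) 1
    (lebesguePoisson2 d C)

/-- The set `Γ_Λ⁽ⁿ'ᵐ⁾` of the `(η⁺, η⁻) ∈ Γ₀²` with `|η⁺| = n`, `|η⁻| = m`,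
`η⁺, η⁻ ⊆ Λ`. -/
def confIn (d n m : ℕ) (Λ : Set (Site d)) : Set (FinConf2 d) :=
  {η | η.1.1.pts.card = n ∧ η.1.2.pts.card = m ∧ (η.1.1.pts : Set (Site d)) ⊆ Λ ∧
    (η.1.2.pts : Set (Site d)) ⊆ Λ}

/-- `N` is integrable over `Γ_Λ⁽ⁿ'ᵐ⁾` for all `n, m ∈ {1, 2, …}` and bounded Borel `Λ`. -/
def LocallyFiniteIntegral {d : ℕ} (N : FinConf2 d → ℝ) : Prop :=
  ∀ n m : ℕ, 1 ≤ n → 1 ≤ m → ∀ Λ : Set (Site d), MeasurableSet Λ → Bornology.IsBounded Λ →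
    IntegrableOn N (confIn d n m Λ) (lebesguePoisson2 d 1)

open scoped Classical in
/-- The bound by `N` for the rates `c₁⁺`, `c₁⁻` of hops that keep the mark. -/
def RateBound1 {d : ℕ} (C : ℝ) (cp cm : Site d → Site d → FinConf2 d → ℝ)
    (N : FinConf2 d → ℝ) : Prop :=
  ∀ᵐ η ∂(lebesguePoisson2 d 1),
    (∑ x ∈ η.1.1.pts,
        (normIntSnd C cp x (η.1.1.pts.erase x) η.1.2.pts +
          normIntFst C cp x (η.1.1.pts.erase x) η.1.2.pts)) +
      (∑ y ∈ η.1.2.pts,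
        (normIntFst C cm y η.1.1.pts (η.1.2.pts.erase y) +
          normIntSnd C cm y η.1.1.pts (η.1.2.pts.erase y)))
      ≤ ENNReal.ofReal (N η)

open scoped Classical in
/-- The bound by `N` for the rates `c₂⁺`, `c₂⁻` of hops that flip the mark. In both rates
`c₂^±(x, y, ·, ·)` the first argument `x` is the site of the `+` particle and the second one, `y`,
is the site of the `-` particle. -/
def RateBound2 {d : ℕ} (C : ℝ) (cp cm : Site d → Site d → FinConf2 d → ℝ)
    (N : FinConf2 d → ℝ) : Prop :=
  ∀ᵐ η ∂(lebesguePoisson2 d 1),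
    (∑ x ∈ η.1.1.pts,
        (normIntSnd C cp x (η.1.1.pts.erase x) η.1.2.pts +
          normIntSnd C cm x (η.1.1.pts.erase x) η.1.2.pts)) +
      (∑ y ∈ η.1.2.pts,
        (normIntFst C cp y η.1.1.pts (η.1.2.pts.erase y) +
          normIntFst C cm y η.1.1.pts (η.1.2.pts.erase y)))
      ≤ ENNReal.ofReal (N η)

open scoped Classical in
/-- `(G(ξ⁺ ∖ x ∪ x', ξ⁻) - G(ξ⁺, ξ⁻)) C₁⁺(x, x', ξ⁺ ∖ x, ξ⁻, η⁺ ∖ ξ⁺, η⁻ ∖ ξ⁻)`. -/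
def term1p {d : ℕ} (cp : Site d → Site d → FinConf2 d → ℝ) (G : FinConf2 d → ℝ)
    (η : FinConf2 d) (ξp ξm : Finset (Site d)) (x x' : Site d) : ℝ :=
  (evalAt G (insert x' (ξp.erase x)) ξm - evalAt G ξp ξm) *
    rateK cp x x' (ξp.erase x) ξm (η.1.1.pts \ ξp) (η.1.2.pts \ ξm)

open scoped Classical in
/-- `(G(ξ⁺, ξ⁻ ∖ y ∪ y') - G(ξ⁺, ξ⁻)) C₁⁻(y, y', ξ⁺, ξ⁻ ∖ y, η⁺ ∖ ξ⁺, η⁻ ∖ ξ⁻)`. -/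
def term1m {d : ℕ} (cm : Site d → Site d → FinConf2 d → ℝ) (G : FinConf2 d → ℝ)
    (η : FinConf2 d) (ξp ξm : Finset (Site d)) (y y' : Site d) : ℝ :=
  (evalAt G ξp (insert y' (ξm.erase y)) - evalAt G ξp ξm) *
    rateK cm y y' ξp (ξm.erase y) (η.1.1.pts \ ξp) (η.1.2.pts \ ξm)

open scoped Classical in
/-- `(G(ξ⁺ ∖ x, ξ⁻ ∪ y) - G(ξ⁺, ξ⁻)) C₂⁺(x, y, ξ⁺ ∖ x, ξ⁻, η⁺ ∖ ξ⁺, η⁻ ∖ ξ⁻)`. -/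
def term2p {d : ℕ} (cp : Site d → Site d → FinConf2 d → ℝ) (G : FinConf2 d → ℝ)
    (η : FinConf2 d) (ξp ξm : Finset (Site d)) (x y : Site d) : ℝ :=
  (evalAt G (ξp.erase x) (insert y ξm) - evalAt G ξp ξm) *
    rateK cp x y (ξp.erase x) ξm (η.1.1.pts \ ξp) (η.1.2.pts \ ξm)

open scoped Classical in
/-- `(G(ξ⁺ ∪ x, ξ⁻ ∖ y) - G(ξ⁺, ξ⁻)) C₂⁻(x, y, ξ⁺, ξ⁻ ∖ y, η⁺ ∖ ξ⁺, η⁻ ∖ ξ⁻)`. -/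
def term2m {d : ℕ} (cm : Site d → Site d → FinConf2 d → ℝ) (G : FinConf2 d → ℝ)
    (η : FinConf2 d) (ξp ξm : Finset (Site d)) (y x : Site d) : ℝ :=
  (evalAt G (insert x ξp) (ξm.erase y) - evalAt G ξp ξm) *
    rateK cm x y ξp (ξm.erase y) (η.1.1.pts \ ξp) (η.1.2.pts \ ξm)

/-- The sum `∑_{ξ⁺ ⊆ η⁺, ξ⁻ ⊆ η⁻} (∑_{x ∈ ξ⁺} ∫ dx' t⁺ + ∑_{y ∈ ξ⁻} ∫ dy' t⁻)`, where
`t⁺ = t⁺(η, ξ⁺, ξ⁻, x, x')` and `t⁻ = t⁻(η, ξ⁺, ξ⁻, y, y')`. -/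
def hopSum {d : ℕ}
    (tp tm : FinConf2 d → Finset (Site d) → Finset (Site d) → Site d → Site d → ℝ)
    (η : FinConf2 d) : ℝ :=
  (∑ ξp ∈ η.1.1.pts.powerset, ∑ ξm ∈ η.1.2.pts.powerset,
      ∑ x ∈ ξp, ∫ x', tp η ξp ξm x x') +
    ∑ ξp ∈ η.1.1.pts.powerset, ∑ ξm ∈ η.1.2.pts.powerset,
      ∑ y ∈ ξm, ∫ y', tm η ξp ξm y y'

/-- All the integrals in `hopSum` converge absolutely. -/
def HopSumConverges {d : ℕ}
    (tp tm : FinConf2 d → Finset (Site d) → Finset (Site d) → Site d → Site d → ℝ)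
    (η : FinConf2 d) : Prop :=
  ∀ ξp ⊆ η.1.1.pts, ∀ ξm ⊆ η.1.2.pts,
    (∀ x ∈ ξp, Integrable (tp η ξp ξm x) volume) ∧ (∀ y ∈ ξm, Integrable (tm η ξp ξm y) volume)

/-- The operator `L` in `𝓛_C` is densely defined with domain `{G ∈ 𝓛_C : N G ∈ 𝓛_C}`. -/
def IsDenselyDefinedOn {d : ℕ} {C : ℝ} (L : LSpace d C →ₗ.[ℝ] LSpace d C)
    (N : FinConf2 d → ℝ) : Prop :=
  Dense (L.domain : Set (LSpace d C)) ∧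
    ∀ G : LSpace d C, G ∈ L.domain ↔
      MemLp (fun η => N η * G η) 1 (lebesguePoisson2 d C)

end

/-! Each operator is a sum of two jump operators: a point `u` of mark `a` leaves `ξ`, a point `u'`
of mark `b` arrives, and the kernel `Φ(u, u', ξ ∖ u, η ∖ ξ)` weights the difference of the two
values of `G`. Everything follows from an `L¹` bound for the sum of the integrals of absolute
values.

By the triangle inequality this sum splits into a part with `|G(ξ)|` and a part with `|G(ξ ∖ u ∪
u')|`. The splitting formula `lintegral_sum_powerset` makes `ξ` and `ζ = η ∖ ξ` independent. In the
first part (`lintegral_stay`) the factor `|G(ξ)|` comes out and leaves the total rate of departure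
from `ξ`. In the second (`lintegral_arrive`) the Mecke formula turns the sum over `u ∈ ξ` into an
integral over `u`, Tonelli exchanges `u` with `u'`, and the Mecke formula is used backwards to
absorb `u'` into the configuration; what remains is `|G(ξ)|` times the total rate of arrival at
points of `ξ`. The assumed bounds say that the departure and arrival rates of the two jumps add up
to at most `N`, so the whole is at most `‖N G‖`.

This bound gives the absolute convergence almost everywhere and the norm estimate. Density of the
domain follows by truncating `G` to `{|N| ≤ k}`. Independence of the representative
(`ae_jumpTerm_congr`) comes from the same two integral formulas, applied to the indicator of a null
set.

Two matters are technical. Measurability on `Γ₀` rests on the fact that its Borel `σ`-algebra is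
generated by countably many events "`η` meets `V`". Disjointness of the two components holds almost
everywhere because `d ≥ 1`, so functions are extended by zero and the computations run over all
pairs in the plain product. -/

open MeasureTheory Set
open scoped ENNReal

/-! ### The `σ`-algebra of the configuration space -/

/-- The event that a configuration has a point in `B`. -/
def hitSet {d : ℕ} (B : Set (Site d)) : Set (FinConf d) := {η | ∃ x ∈ η.pts, x ∈ B}

lemma isOpen_hitSet {d : ℕ} {B : Set (Site d)} (hB : IsOpen B) : IsOpen (hitSet B) := by
  refine isOpen_iSup_iff.2 fun n => isOpen_coinduced.2 ?_
  have : confOfTuple d n ⁻¹' hitSet B = ⋃ i, {v : DistinctTuple d n | v.1 i ∈ B} := by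
    ext v; simp [hitSet, confOfTuple]
  rw [this]
  exact isOpen_iUnion fun i => hB.preimage ((continuous_apply i).comp continuous_subtype_val)

lemma measurableSet_hitSet {d : ℕ} {B : Set (Site d)} (hB : IsOpen B) :
    MeasurableSet (hitSet B) :=
  (isOpen_hitSet hB).measurableSet

/-- A finite set is closed, so its complement is open. This is how membership of single points is
expressed through countably many hitting events. -/
lemma exists_basis_subset_avoiding {d : ℕ} (ζ : Finset (Site d)) {x : Site d} (hx : x ∉ ζ)
    {B : Set (Site d)} (hB : IsOpen B) (hxB : x ∈ B) :
    ∃ V ∈ TopologicalSpace.countableBasis (Site d), x ∈ V ∧ V ⊆ B ∧ ∀ y ∈ ζ, y ∉ V := by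
  obtain ⟨V, hV, hxV, hVs⟩ := (TopologicalSpace.isBasis_countableBasis (Site d)).exists_subset_of_mem_open
    (show x ∈ B ∩ (ζ : Set (Site d))ᶜ from ⟨hxB, by simpa using hx⟩)
    (hB.inter ζ.finite_toSet.isClosed.isOpen_compl)
  exact ⟨V, hV, hxV, fun y hy => (hVs hy).1, fun y hy hyV => (hVs hyV).2 hy⟩

/-- The countable family of the events generating the `σ`-algebra. -/
def hitFamily (d : ℕ) : Set (Set (FinConf d)) :=
  hitSet '' TopologicalSpace.countableBasis (Site d)

lemma hitFamily_countable (d : ℕ) : (hitFamily d).Countable :=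
  (TopologicalSpace.countable_countableBasis _).image _

/-- A point of `η` missing from `ζ` has a basic neighbourhood that avoids `ζ`, and hitting this
neighbourhood tells `η` from `ζ`. -/
lemma countablySeparated_generateFrom_hitFamily (d : ℕ) :
    @MeasurableSpace.CountablySeparated (FinConf d) (MeasurableSpace.generateFrom (hitFamily d)) := by
  let := MeasurableSpace.generateFrom (hitFamily d)
  refine ⟨⟨hitFamily d, hitFamily_countable d,
    fun s hs => MeasurableSpace.measurableSet_generateFrom hs, ?_⟩⟩
  have key : ∀ η ζ : FinConf d, (∀ s ∈ hitFamily d, η ∈ s ↔ ζ ∈ s) → η.pts ⊆ ζ.pts := by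
    intro η ζ h x hx
    by_contra hxζ
    obtain ⟨V, hV, hxV, -, hav⟩ := exists_basis_subset_avoiding ζ.pts hxζ isOpen_univ (mem_univ x)
    obtain ⟨y, hy, hyV⟩ := (h _ (mem_image_of_mem _ hV)).1 ⟨x, hx, hxV⟩
    exact hav y hy hyV
  intro η _ ζ _ h
  exact FinConf.ext (Finset.Subset.antisymm (key η ζ h) (key ζ η fun s hs => (h s hs).symm))

lemma isOpen_setOf_injective (d n : ℕ) :
    IsOpen {v : Fin n → Site d | Function.Injective v} := by
  have : {v : Fin n → Site d | Function.Injective v}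
      = ⋂ i, ⋂ j, {v : Fin n → Site d | i ≠ j → v i ≠ v j} := by
    ext v
    simp only [mem_ofPred_eq, mem_iInter, Function.Injective]
    exact ⟨fun h i j hij e => hij (h e), fun h i j e => by_contra fun hij => h i j hij e⟩
  rw [this]
  refine isOpen_iInter_of_finite fun i => isOpen_iInter_of_finite fun j => ?_
  by_cases hij : i = j
  · simp [hij]
  · simpa [hij] using isOpen_ne_fun (continuous_apply i) (continuous_apply j)

instance distinctTuple_polishSpace (d n : ℕ) : PolishSpace (DistinctTuple d n) :=
  (isOpen_setOf_injective d n).polishSpace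

lemma continuous_confOfTuple (d n : ℕ) : Continuous (confOfTuple d n) :=
  continuous_iff_coinduced_le.2 (le_iSup (fun n => TopologicalSpace.coinduced (confOfTuple d n) _) n)

lemma confOfTuple_surjective {d : ℕ} (η : FinConf d) :
    confOfTuple d η.pts.card ⟨fun i => (η.pts.equivFin.symm i : Site d),
      Subtype.val_injective.comp (Equiv.injective _)⟩ = η := by
  ext x
  simp only [confOfTuple, Finset.mem_map, Finset.mem_univ, true_and, Function.Embedding.coeFn_mk]
  exact ⟨fun ⟨i, hi⟩ => hi ▸ (η.pts.equivFin.symm i).2,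
    fun hx => ⟨η.pts.equivFin ⟨x, hx⟩, by simp⟩⟩

/-- A set of configurations whose preimages in the spaces of tuples are Borel sets belongs to the
`σ`-algebra generated by the hitting events. -/
lemma measurableSet_generateFrom_hitFamily {d : ℕ} {s : Set (FinConf d)}
    (hs : ∀ n, MeasurableSet (confOfTuple d n ⁻¹' s)) :
    MeasurableSet[MeasurableSpace.generateFrom (hitFamily d)] s := by
  let X := Σ n, DistinctTuple d n
  let f : X → FinConf d := fun p => confOfTuple d p.1 p.2
  have hf : Continuous f := continuous_sigma fun n => continuous_confOfTuple d n
  have hsurj : Function.Surjective f := fun η => ⟨⟨_, _⟩, confOfTuple_surjective η⟩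
  let : MeasurableSpace X := borel X
  have : BorelSpace X := ⟨rfl⟩
  have hle : MeasurableSpace.generateFrom (hitFamily d) ≤ borel (FinConf d) := by
    refine MeasurableSpace.generateFrom_le ?_
    rintro _ ⟨B, hB, rfl⟩
    exact measurableSet_hitSet (TopologicalSpace.isOpen_of_mem_countableBasis hB)
  have hfm : @Measurable X (FinConf d) _ (MeasurableSpace.generateFrom (hitFamily d)) f :=
    hf.measurable.mono le_rfl hle
  -- The disjoint union `X` of the tuple spaces is Polish. The images of `f ⁻¹' s` and of its
  -- complement are disjoint analytic sets covering the target, so Souslin's separation argument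
  -- makes `s` measurable in any countably separated `σ`-algebra for which `f` is measurable.
  refine (@Measurable.measurableSet_preimage_iff_of_surjective X (FinConf d) _ _
    (MeasurableSpace.generateFrom (hitFamily d)) (countablySeparated_generateFrom_hitFamily d)
    f hfm hsurj s).1 ?_
  have : f ⁻¹' s = ⋃ n, Sigma.mk n '' (confOfTuple d n ⁻¹' s) := by
    ext ⟨n, v⟩
    simp only [mem_preimage, mem_iUnion, mem_image]
    constructor
    · intro h
      exact ⟨n, v, h, rfl⟩
    · rintro ⟨m, w, h, e⟩
      rw [← e]; exact h
  rw [this]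
  exact MeasurableSet.iUnion fun n =>
    (Topology.IsOpenEmbedding.sigmaMk.measurableEmbedding).measurableSet_image.2 (hs n)

lemma measurable_confOfTuple (d n : ℕ) : Measurable (confOfTuple d n) :=
  (continuous_confOfTuple d n).measurable

/-- The generated `σ`-algebra contains every set with Borel preimages on tuples, hence every Borel
set. Measurability of maps into `Γ₀` can thus be tested on hitting events, and of maps out of `Γ₀`
on tuples. -/
lemma finConfMeasurableSpace_eq (d : ℕ) :
    finConfMeasurableSpace d = MeasurableSpace.generateFrom (hitFamily d) := by
  refine le_antisymm (fun s hs => measurableSet_generateFrom_hitFamily fun n =>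
    measurable_confOfTuple d n hs) (MeasurableSpace.generateFrom_le ?_)
  rintro _ ⟨B, hB, rfl⟩
  exact measurableSet_hitSet (TopologicalSpace.isOpen_of_mem_countableBasis hB)

instance finConf_countablySeparated (d : ℕ) : MeasurableSpace.CountablySeparated (FinConf d) := by
  have := countablySeparated_generateFrom_hitFamily d
  rwa [← finConfMeasurableSpace_eq] at this

instance finConf_measurableSingletonClass (d : ℕ) : MeasurableSingletonClass (FinConf d) :=
  MeasurableSpace.measurableSingletonClass_of_countablySeparated

lemma measurable_of_comp_confOfTuple {d : ℕ} {β : Type*} [MeasurableSpace β] {f : FinConf d → β}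
    (hf : ∀ n, Measurable (f ∘ confOfTuple d n)) : Measurable f := fun s hs => by
  have := measurableSet_generateFrom_hitFamily (s := f ⁻¹' s) fun n => hf n hs
  rwa [← finConfMeasurableSpace_eq] at this

lemma measurable_finConf_mk {d : ℕ} {α : Type*} [MeasurableSpace α] {f : α → Finset (Site d)}
    (hf : ∀ B, IsOpen B → MeasurableSet {a | ∃ x ∈ f a, x ∈ B}) :
    Measurable fun a => (⟨f a⟩ : FinConf d) := by
  rw [finConfMeasurableSpace_eq]
  refine measurable_generateFrom ?_
  rintro _ ⟨B, hB, rfl⟩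
  exact hf B (TopologicalSpace.isOpen_of_mem_countableBasis hB)

/-! ### Measurability of the set operations on configurations. -/

section operations

open scoped Classical

variable {d : ℕ} {α : Type*} [MeasurableSpace α]

lemma measurableSet_hit {f : α → FinConf d} (hf : Measurable f) {B : Set (Site d)}
    (hB : IsOpen B) : MeasurableSet {a | ∃ x ∈ (f a).pts, x ∈ B} :=
  hf (measurableSet_hitSet hB)

lemma measurable_conf_union {f g : α → FinConf d} (hf : Measurable f) (hg : Measurable g) :
    Measurable fun a => (⟨(f a).pts ∪ (g a).pts⟩ : FinConf d) := by
  refine measurable_finConf_mk fun B hB => ?_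
  convert (measurableSet_hit hf hB).union (measurableSet_hit hg hB) using 1
  ext a
  simp only [Finset.mem_union, mem_ofPred_eq, mem_union]
  grind

lemma measurable_conf_sdiff {f g : α → FinConf d} (hf : Measurable f) (hg : Measurable g) :
    Measurable fun a => (⟨(f a).pts \ (g a).pts⟩ : FinConf d) := by
  refine measurable_finConf_mk fun B hB => ?_
  -- The difference meets `B` exactly when some basic `V ⊆ B` meets the first configuration and
  -- misses the second.
  have : {a | ∃ x ∈ (f a).pts \ (g a).pts, x ∈ B} =
      ⋃ V ∈ {V ∈ TopologicalSpace.countableBasis (Site d) | V ⊆ B},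
        {a | ∃ x ∈ (f a).pts, x ∈ V} ∩ {a | ∃ x ∈ (g a).pts, x ∈ V}ᶜ := by
    ext a
    simp only [Finset.mem_sdiff, mem_ofPred_eq, mem_iUnion, mem_inter_iff, mem_compl_iff,
      exists_prop]
    constructor
    · rintro ⟨x, ⟨hx, hxg⟩, hxB⟩
      obtain ⟨V, hV, hxV, hVB, hav⟩ := exists_basis_subset_avoiding _ hxg hB hxB
      exact ⟨V, ⟨hV, hVB⟩, ⟨x, hx, hxV⟩, fun ⟨y, hy, hyV⟩ => hav y hy hyV⟩
    · rintro ⟨V, ⟨-, hVB⟩, ⟨x, hx, hxV⟩, h⟩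
      exact ⟨x, ⟨hx, fun hxg => h ⟨x, hxg, hxV⟩⟩, hVB hxV⟩
  rw [this]
  refine MeasurableSet.biUnion ((TopologicalSpace.countable_countableBasis _).mono fun V h => h.1)
    fun V hV => ?_
  have hVo := TopologicalSpace.isOpen_of_mem_countableBasis hV.1
  exact (measurableSet_hit hf hVo).inter (measurableSet_hit hg hVo).compl

lemma measurable_conf_singleton {u : α → Site d} (hu : Measurable u) :
    Measurable fun a => (⟨{u a}⟩ : FinConf d) := by
  refine measurable_finConf_mk fun B hB => ?_
  simp only [Finset.mem_singleton, exists_eq_left]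
  exact hu hB.measurableSet

lemma measurable_conf_insert {u : α → Site d} {f : α → FinConf d} (hu : Measurable u)
    (hf : Measurable f) : Measurable fun a => (⟨insert (u a) (f a).pts⟩ : FinConf d) := by
  simpa only [Finset.insert_eq] using measurable_conf_union (measurable_conf_singleton hu) hf

lemma measurable_conf_erase {u : α → Site d} {f : α → FinConf d} (hu : Measurable u)
    (hf : Measurable f) : Measurable fun a => (⟨(f a).pts.erase (u a)⟩ : FinConf d) := by
  simpa only [Finset.sdiff_singleton_eq_erase] using
    measurable_conf_sdiff hf (measurable_conf_singleton hu)

lemma measurable_conf_image {ι : Type*} [Fintype ι] (s : Finset ι) :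
    Measurable fun v : ι → Site d => (⟨s.image v⟩ : FinConf d) := by
  refine measurable_finConf_mk fun B hB => ?_
  have : {v : ι → Site d | ∃ x ∈ s.image v, x ∈ B} = ⋃ i ∈ s, {v | v i ∈ B} := by
    ext v; simp
  rw [this]
  exact MeasurableSet.biUnion s.countable_toSet fun i _ =>
    measurable_pi_apply i hB.measurableSet

lemma measurableSet_conf_disjoint :
    MeasurableSet {p : FinConf d × FinConf d | Disjoint p.1.pts p.2.pts} := by
  -- Disjointness means that every basic set meeting `p.1` still meets `p.1 ∖ p.2`: a common point
  -- `x` is detected by a neighbourhood of `x` that contains no other point of `p.1`.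
  have h : {p : FinConf d × FinConf d | Disjoint p.1.pts p.2.pts}
      = ⋂ V ∈ TopologicalSpace.countableBasis (Site d),
        {p | ∃ x ∈ p.1.pts, x ∈ V}ᶜ ∪ {p | ∃ x ∈ p.1.pts \ p.2.pts, x ∈ V} := by
    ext p
    simp only [mem_ofPred_eq, mem_iInter, mem_union, mem_compl_iff]
    constructor
    · intro h V _
      rw [Finset.sdiff_eq_self_of_disjoint h]
      exact (em _).symm
    · intro h
      refine Finset.disjoint_left.2 fun x hx hx' => ?_
      obtain ⟨V, hV, hxV, -, hav⟩ := exists_basis_subset_avoiding (p.1.pts.erase x)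
        (Finset.notMem_erase x _) isOpen_univ (mem_univ x)
      rcases h V hV with h | ⟨y, hy, hyV⟩
      · exact h ⟨x, hx, hxV⟩
      · have hyx : y ≠ x := fun e => (Finset.mem_sdiff.1 hy).2 (e ▸ hx')
        exact hav y (Finset.mem_erase.2 ⟨hyx, (Finset.mem_sdiff.1 hy).1⟩) hyV
  rw [h]
  refine MeasurableSet.biInter (TopologicalSpace.countable_countableBasis _) fun V hV => ?_
  have hVo := TopologicalSpace.isOpen_of_mem_countableBasis hV
  exact (measurableSet_hit measurable_fst hVo).compl.union
    (measurableSet_hit (measurable_conf_sdiff measurable_fst measurable_snd) hVo)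

end operations

/-! ### Measurability of finite sums over random finite sets -/

section finiteSums

open ProbabilityTheory

variable {α β γ : Type*} [MeasurableSpace α] [MeasurableSpace β] [MeasurableSpace γ]

/-- The finite set valued map `t` is measurable: it counts points measurably. -/
def MeasurablyCounts (t : β → Finset γ) : Prop :=
  ∀ A : Set γ, MeasurableSet A → Measurable fun b => ∑ x ∈ t b, A.indicator (1 : γ → ℝ≥0∞) x

/-- The kernel of counting measures on the sets `t b`. -/
noncomputable def countKernel (t : β → Finset γ) (ht : MeasurablyCounts t) : Kernel β γ where
  toFun b := ∑ x ∈ t b, Measure.dirac x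
  measurable' := by
    refine Measure.measurable_of_measurable_coe _ fun A hA => ?_
    simpa only [Measure.coe_finsetSum, Finset.sum_apply, Measure.dirac_apply' _ hA] using ht A hA

lemma countKernel_apply (t : β → Finset γ) (ht : MeasurablyCounts t) (b : β) :
    countKernel t ht b = ∑ x ∈ t b, Measure.dirac x := rfl

/-- The number of points is finite but unbounded, so the kernel is cut along the level sets of the
cardinality; the piece with `n` points has mass at most `n`. -/
instance countKernel_isSFiniteKernel (t : β → Finset γ) (ht : MeasurablyCounts t) :
    IsSFiniteKernel (countKernel t ht) := by
  classical
  have hcard : ∀ n : ℕ, MeasurableSet {b | (t b).card = n} := fun n => by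
    have := ht univ MeasurableSet.univ (measurableSet_singleton (n : ℝ≥0∞))
    simpa [preimage, Nat.cast_inj] using this
  refine ⟨⟨fun n => Kernel.piecewise (hcard n) (countKernel t ht) 0, fun n => ?_, ?_⟩⟩
  · refine ⟨⟨n, by simp, fun b => ?_⟩⟩
    rw [Kernel.piecewise_apply]
    split_ifs with h
    · simp only [mem_ofPred_eq] at h
      simp [countKernel_apply, h]
    · simp
  · ext b A hA
    rw [Kernel.sum_apply' _ _ hA, tsum_eq_single (t b).card]
    · simp [Kernel.piecewise_apply]
    · intro n hn
      have : b ∉ {b | (t b).card = n} := fun h => hn h.symm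
      simp [Kernel.piecewise_apply, this]

variable [MeasurableSingletonClass γ]

/-- The sum is an integral against the counting kernel, so measurability with respect to a parameter
is that of kernel integrals. -/
lemma MeasurablyCounts.measurable_sum {t : β → Finset γ} (ht : MeasurablyCounts t) {g : α → β}
    (hg : Measurable g) {f : α → γ → ℝ≥0∞} (hf : Measurable (Function.uncurry f)) :
    Measurable fun a => ∑ x ∈ t (g a), f a x := by
  have := Measurable.lintegral_kernel_prod_right (κ := (countKernel t ht).comap g hg) hf
  simpa only [Kernel.comap_apply, countKernel_apply, lintegral_finsetSum_measure,
    lintegral_dirac] using this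

lemma MeasurablyCounts.measurable_sum_real {t : β → Finset γ} (ht : MeasurablyCounts t)
    {g : α → β} (hg : Measurable g) {f : α → γ → ℝ} (hf : Measurable (Function.uncurry f)) :
    Measurable fun a => ∑ x ∈ t (g a), f a x := by
  have := (StronglyMeasurable.integral_kernel_prod_right (κ := (countKernel t ht).comap g hg)
    hf.stronglyMeasurable).measurable
  convert this using 2 with a
  rw [Kernel.comap_apply, countKernel_apply,
    integral_finsetSum_measure fun i _ => integrable_dirac (by simp)]
  simp only [integral_dirac]

end finiteSums

/-! ### Sums over the points and over the subconfigurations of a configuration. -/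

section configurationSums

variable {d : ℕ} {α : Type*} [MeasurableSpace α]

lemma measurablyCounts_pts (d : ℕ) : MeasurablyCounts fun η : FinConf d => η.pts := by
  refine fun A hA => measurable_of_comp_confOfTuple fun n => ?_
  simp only [Function.comp_def, confOfTuple, Finset.sum_map, Function.Embedding.coeFn_mk]
  refine Finset.measurable_sum _ fun i _ => ?_
  exact (measurable_one.indicator hA).comp ((measurable_pi_apply i).comp measurable_subtype_coe)

/-- The subconfigurations of a configuration. -/
def subConf {d : ℕ} (η : FinConf d) : Finset (FinConf d) :=
  η.pts.powerset.map ⟨FinConf.mk, fun _ _ h => congrArg FinConf.pts h⟩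

lemma sum_subConf {d : ℕ} {M : Type*} [AddCommMonoid M] (η : FinConf d) (f : FinConf d → M) :
    ∑ ξ ∈ subConf η, f ξ = ∑ s ∈ η.pts.powerset, f ⟨s⟩ :=
  Finset.sum_map _ _ _

/-- On tuples of distinct points the subconfigurations are indexed by the subsets of `Fin n`, so the
random index set becomes a fixed one. -/
lemma measurablyCounts_subConf (d : ℕ) : MeasurablyCounts (subConf (d := d)) := by
  classical
  refine fun A hA => measurable_of_comp_confOfTuple fun n => ?_
  have : ((fun η => ∑ ξ ∈ subConf η, A.indicator (1 : FinConf d → ℝ≥0∞) ξ) ∘ confOfTuple d n)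
      = fun v => ∑ s : Finset (Fin n), A.indicator (1 : FinConf d → ℝ≥0∞) ⟨s.image v.1⟩ := by
    funext v
    simp only [Function.comp_def, sum_subConf, confOfTuple, Function.Embedding.coeFn_mk,
      Finset.map_eq_image, Finset.powerset_image]
    rw [Finset.sum_image (Finset.image_injective v.2).injOn, Finset.powerset_univ]
  rw [this]
  refine Finset.measurable_sum _ fun s _ => ?_
  exact (measurable_one.indicator hA).comp ((measurable_conf_image s).comp measurable_subtype_coe)

lemma measurable_sum_pts {g : α → FinConf d} (hg : Measurable g) {f : α → Site d → ℝ≥0∞}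
    (hf : Measurable (Function.uncurry f)) : Measurable fun a => ∑ x ∈ (g a).pts, f a x :=
  (measurablyCounts_pts d).measurable_sum hg hf

lemma measurable_sum_pts_real {g : α → FinConf d} (hg : Measurable g) {f : α → Site d → ℝ}
    (hf : Measurable (Function.uncurry f)) : Measurable fun a => ∑ x ∈ (g a).pts, f a x :=
  (measurablyCounts_pts d).measurable_sum_real hg hf

lemma measurable_sum_powerset {g : α → FinConf d} (hg : Measurable g)
    {f : α → FinConf d → ℝ≥0∞} (hf : Measurable (Function.uncurry f)) :
    Measurable fun a => ∑ ξ ∈ (g a).pts.powerset, f a ⟨ξ⟩ := by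
  simpa only [sum_subConf] using (measurablyCounts_subConf d).measurable_sum hg hf

lemma measurable_sum_powerset_real {g : α → FinConf d} (hg : Measurable g)
    {f : α → FinConf d → ℝ} (hf : Measurable (Function.uncurry f)) :
    Measurable fun a => ∑ ξ ∈ (g a).pts.powerset, f a ⟨ξ⟩ := by
  simpa only [sum_subConf] using (measurablyCounts_subConf d).measurable_sum_real hg hf

lemma measurable_conf_card {g : α → FinConf d} (hg : Measurable g) :
    Measurable fun a => (g a).pts.card := by
  have : Measurable fun η : FinConf d => η.pts.card :=
    measurable_of_comp_confOfTuple fun n => by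
      simp only [Function.comp_def, confOfTuple, Finset.card_map]; exact measurable_const
  exact this.comp hg

end configurationSums

/-! ### Integrals with respect to the Lebesgue–Poisson measure -/

section integrals

open scoped Classical

variable {d : ℕ}

lemma site_nontrivial (hd : 1 ≤ d) : Nontrivial (Site d) :=
  haveI : Nonempty (Fin d) := ⟨⟨0, hd⟩⟩
  inferInstance

/-- The tuples with `v i = v j` form a linear subspace, which is proper because `d ≥ 1`, hence
Lebesgue null. -/
lemma ae_injective_tuple (hd : 1 ≤ d) (ι : Type*) [Fintype ι] :
    ∀ᵐ v : ι → Site d, Function.Injective v := by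
  have := site_nontrivial hd
  have h : ∀ i j : ι, ∀ᵐ v : ι → Site d, i ≠ j → v i ≠ v j := by
    intro i j
    by_cases hij : i = j
    · simp [hij]
    let K : Submodule ℝ (ι → Site d) :=
      LinearMap.ker (LinearMap.proj (R := ℝ) (φ := fun _ : ι => Site d) i - LinearMap.proj j)
    have hK : K ≠ ⊤ := by
      obtain ⟨x, hx⟩ := exists_ne (0 : Site d)
      intro hK
      have : Pi.single i x ∈ K := hK ▸ Submodule.mem_top
      simp [K, hx, Ne.symm hij] at this
    have h0 := Measure.addHaar_submodule (volume : Measure (ι → Site d)) K hK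
    have : (K : Set (ι → Site d))ᶜ ∈ ae volume := compl_mem_ae_iff.2 h0
    filter_upwards [this] with v hv _ e
    exact hv (by simp [K, e])
  have h' := ae_all_iff.2 fun i => ae_all_iff.2 (h i)
  filter_upwards [h'] with v hv i j e
  exact by_contra fun hij => hv i j hij e

instance symLebesgue_sFinite (d n : ℕ) : SFinite (symLebesgue d n) := by
  have hmap : Measure.map Subtype.val
      (Measure.comap (Subtype.val : DistinctTuple d n → (Fin n → Site d)) volume) = _ :=
    (MeasurableEmbedding.subtype_coe (isOpen_setOf_injective d n).measurableSet).map_comap volume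
  have : SigmaFinite (Measure.comap (Subtype.val : DistinctTuple d n → (Fin n → Site d)) volume) :=
    SigmaFinite.of_map _ measurable_subtype_coe.aemeasurable (by
      rw [hmap]
      infer_instance)
  unfold symLebesgue
  infer_instance

instance lebesguePoisson_sFinite (d : ℕ) (z : ℝ) : SFinite (lebesguePoisson d z) := by
  unfold lebesguePoisson
  infer_instance

/-- Tuples with repeated points, whose image is too small, are negligible. An arbitrary index type
is allowed so that the coordinates in a subset of `Fin n` and in its complement need no renumbering.
-/
lemma lintegral_symLebesgue (hd : 1 ≤ d) {n : ℕ} {ι : Type*} [Fintype ι]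
    (hι : Fintype.card ι = n) {F : FinConf d → ℝ≥0∞} (hF : Measurable F) :
    ∫⁻ η, F η ∂(symLebesgue d n) = ∫⁻ v : ι → Site d, F ⟨Finset.univ.image v⟩ := by
  have h1 : ∫⁻ η, F η ∂(symLebesgue d n) =
      ∫⁻ v : Fin n → Site d, F ⟨Finset.univ.image v⟩ := by
    have hs := (isOpen_setOf_injective d n).measurableSet
    rw [symLebesgue, lintegral_map hF (measurable_confOfTuple d n)]
    have : ∀ v : DistinctTuple d n, F (confOfTuple d n v) = F ⟨Finset.univ.image v.1⟩ := by
      intro v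
      simp [confOfTuple, Finset.map_eq_image]
    simp_rw [this]
    have h := lintegral_subtype_comap (μ := volume) hs
      (fun v : Fin n → Site d => F ⟨Finset.univ.image v⟩)
    refine h.trans ?_
    rw [Measure.restrict_eq_self_of_ae_mem (s := {v | Function.Injective v})
      (ae_injective_tuple hd (Fin n))]
  rw [h1]
  let e : ι ≃ Fin n := Fintype.equivFinOfCardEq hι
  have hp := volume_measurePreserving_piCongrLeft (fun _ : Fin n => Site d) e
  refine (hp.lintegral_comp (hF.comp (measurable_conf_image Finset.univ))).symm.trans ?_
  refine lintegral_congr fun v => ?_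
  simp only [Function.comp_apply]
  congr 2
  ext x
  simp only [Finset.mem_image, Finset.mem_univ, true_and]
  constructor
  · rintro ⟨i, rfl⟩
    exact ⟨e.symm i, by
      simp [MeasurableEquiv.coe_piCongrLeft, Equiv.piCongrLeft_apply]⟩
  · rintro ⟨i, rfl⟩
    exact ⟨e i, by
      simp [MeasurableEquiv.coe_piCongrLeft, Equiv.piCongrLeft_apply]⟩

lemma lintegral_lebesguePoisson (z : ℝ) (F : FinConf d → ℝ≥0∞) :
    ∫⁻ η, F η ∂(lebesguePoisson d z) =
      ∑' n : ℕ, ENNReal.ofReal (z ^ n / (n.factorial : ℝ)) * ∫⁻ η, F η ∂(symLebesgue d n) := by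
  simp [lebesguePoisson, lintegral_sum_measure]

lemma sum_powerset_image_eq (n : ℕ) {v : Fin n → Site d} (hv : Function.Injective v)
    {M : Type*} [AddCommMonoid M] (F : FinConf d → FinConf d → M) :
    ∑ s ∈ (Finset.univ.image v).powerset, F ⟨s⟩ ⟨Finset.univ.image v \ s⟩ =
      ∑ s : Finset (Fin n), F ⟨s.image v⟩ ⟨sᶜ.image v⟩ := by
  rw [Finset.powerset_image, Finset.sum_image (Finset.image_injective hv).injOn,
    Finset.powerset_univ]
  refine Finset.sum_congr rfl fun s _ => ?_
  rw [← Finset.image_sdiff _ _ hv, ← Finset.compl_eq_univ_sdiff]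

lemma lintegral_split_tuple (hd : 1 ≤ d) {n : ℕ} (s : Finset (Fin n))
    {F : FinConf d → FinConf d → ℝ≥0∞} (hF : Measurable (Function.uncurry F)) :
    ∫⁻ v : Fin n → Site d, F ⟨s.image v⟩ ⟨sᶜ.image v⟩ =
      ∫⁻ ξ, ∫⁻ ζ, F ξ ζ ∂(symLebesgue d (n - s.card)) ∂(symLebesgue d s.card) := by
  have hp := volume_preserving_piEquivPiSubtypeProd (fun _ : Fin n => Site d) (fun i => i ∈ s)
  have hm : Measurable fun p : ({i // i ∈ s} → Site d) × ({i // ¬ i ∈ s} → Site d) =>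
      F ⟨Finset.univ.image p.1⟩ ⟨Finset.univ.image p.2⟩ :=
    hF.comp (((measurable_conf_image _).comp measurable_fst).prodMk
      ((measurable_conf_image _).comp measurable_snd))
  have h1 : ∫⁻ v : Fin n → Site d, F ⟨s.image v⟩ ⟨sᶜ.image v⟩ =
      ∫⁻ p : ({i // i ∈ s} → Site d) × ({i // ¬ i ∈ s} → Site d),
        F ⟨Finset.univ.image p.1⟩ ⟨Finset.univ.image p.2⟩ := by
    refine Eq.trans ?_ ((hp.lintegral_comp hm).trans (by congr!))
    refine lintegral_congr fun v => ?_
    congr 2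
    · ext x; simp [MeasurableEquiv.piEquivPiSubtypeProd, Equiv.piEquivPiSubtypeProd]
    · ext x; simp [MeasurableEquiv.piEquivPiSubtypeProd, Equiv.piEquivPiSubtypeProd]
  have hm' : Measurable fun ξ => ∫⁻ ζ, F ξ ζ ∂(symLebesgue d (n - s.card)) :=
    hF.lintegral_prod_right'
  rw [h1, Measure.volume_eq_prod, lintegral_prod _ hm.aemeasurable,
    lintegral_symLebesgue hd (ι := {i // i ∈ s}) (by simp) hm']
  refine lintegral_congr fun u => ?_
  exact (lintegral_symLebesgue hd (ι := {i // ¬ i ∈ s}) (F := F ⟨Finset.univ.image u⟩)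
    (by rw [Fintype.card_subtype_compl]; simp) (hF.comp measurable_prodMk_left)).symm

lemma ofReal_poisson_weight_mul_choose {z : ℝ} (hz : 0 ≤ z) (k l : ℕ) :
    ENNReal.ofReal (z ^ (k + l) / ((k + l).factorial : ℝ)) * ((k + l).choose k : ℕ) =
      ENNReal.ofReal (z ^ k / (k.factorial : ℝ)) * ENNReal.ofReal (z ^ l / (l.factorial : ℝ)) := by
  rw [← ENNReal.ofReal_natCast, ← ENNReal.ofReal_mul (by positivity),
    ← ENNReal.ofReal_mul (by positivity)]
  congr 1
  have h := Nat.add_choose_mul_factorial_mul_factorial k l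
  rw [← Nat.choose_symm_add] at h
  have h' : ((k + l).choose k : ℝ) * k.factorial * l.factorial = (k + l).factorial := by
    exact_mod_cast h
  have h1 : (k.factorial : ℝ) ≠ 0 := by positivity
  have h2 : (l.factorial : ℝ) ≠ 0 := by positivity
  have h3 : ((k + l).factorial : ℝ) ≠ 0 := by positivity
  field_simp
  rw [pow_add, ← h']
  ring

/-- The formula for the integral of a sum over all splittings of a configuration into two parts. -/
lemma lintegral_sum_powerset (hd : 1 ≤ d) {z : ℝ} (hz : 0 ≤ z)
    {F : FinConf d → FinConf d → ℝ≥0∞} (hF : Measurable (Function.uncurry F)) :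
    ∫⁻ η, ∑ s ∈ η.pts.powerset, F ⟨s⟩ ⟨η.pts \ s⟩ ∂(lebesguePoisson d z) =
      ∫⁻ ξ, ∫⁻ ζ, F ξ ζ ∂(lebesguePoisson d z) ∂(lebesguePoisson d z) := by
  set c : ℕ → ℝ≥0∞ := fun n => ENNReal.ofReal (z ^ n / (n.factorial : ℝ)) with hc
  set I : ℕ → ℕ → ℝ≥0∞ := fun k l =>
    ∫⁻ ξ, ∫⁻ ζ, F ξ ζ ∂(symLebesgue d l) ∂(symLebesgue d k) with hI
  have hmeas : Measurable fun η : FinConf d => ∑ s ∈ η.pts.powerset, F ⟨s⟩ ⟨η.pts \ s⟩ :=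
    measurable_sum_powerset (f := fun η ξ => F ξ ⟨η.pts \ ξ.pts⟩) measurable_id
      (hF.comp (measurable_snd.prodMk (measurable_conf_sdiff measurable_fst measurable_snd)))
  have hL : ∀ n, ∫⁻ η, ∑ s ∈ η.pts.powerset, F ⟨s⟩ ⟨η.pts \ s⟩ ∂(symLebesgue d n) =
      ∑ p ∈ Finset.HasAntidiagonal.antidiagonal n, ((p.1 + p.2).choose p.1 : ℕ) * I p.1 p.2 := by
    intro n
    rw [lintegral_symLebesgue hd (ι := Fin n) (by simp) hmeas]
    have h1 : (fun v : Fin n → Site d => ∑ s ∈ (Finset.univ.image v).powerset,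
          F ⟨s⟩ ⟨Finset.univ.image v \ s⟩) =ᵐ[volume]
        fun v => ∑ s : Finset (Fin n), F ⟨s.image v⟩ ⟨sᶜ.image v⟩ := by
      filter_upwards [ae_injective_tuple hd (Fin n)] with v hv
      exact sum_powerset_image_eq n hv F
    rw [lintegral_congr_ae h1, lintegral_finsetSum]
    -- The integral depends on the index set `s` only through its cardinality `k`, so the sum over
    -- `s` produces binomial coefficients.
    · simp_rw [lintegral_split_tuple hd _ hF]
      rw [← Finset.powerset_univ, Finset.sum_powerset_apply_card fun k => I k (n - k),
        Finset.Nat.sum_antidiagonal_eq_sum_range_succ_mk]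
      simp only [Finset.card_univ, Fintype.card_fin]
      refine Finset.sum_congr rfl fun k hk => ?_
      have : k + (n - k) = n := by
        have := Finset.mem_range.1 hk
        omega
      rw [this, nsmul_eq_mul]
    · intro s _
      exact hF.comp ((measurable_conf_image s).prodMk (measurable_conf_image sᶜ))
  have hR : ∫⁻ ξ, ∫⁻ ζ, F ξ ζ ∂(lebesguePoisson d z) ∂(lebesguePoisson d z) =
      ∑' k, ∑' l, c k * c l * I k l := by
    rw [lintegral_lebesguePoisson]
    refine tsum_congr fun k => ?_
    simp_rw [lintegral_lebesguePoisson z, hI]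
    have hm : ∀ l, Measurable fun ξ => ∫⁻ ζ, F ξ ζ ∂(symLebesgue d l) := fun l =>
      hF.lintegral_prod_right'
    rw [lintegral_tsum fun l => ((hm l).const_mul _).aemeasurable, ← ENNReal.tsum_mul_left]
    refine tsum_congr fun l => ?_
    rw [lintegral_const_mul _ (hm l), mul_assoc]
  -- The double series is regrouped by the total number `n = k + l` of points; the binomial
  -- coefficient turns the weight of `n` into the product of the weights of `k` and `l`.
  rw [hR, lintegral_lebesguePoisson, ← ENNReal.tsum_prod,
    ← Finset.HasAntidiagonal.sigmaAntidiagonalEquivProd.tsum_eq, ENNReal.tsum_sigma']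
  refine tsum_congr fun n => ?_
  rw [hL, Finset.mul_sum, tsum_fintype, Finset.univ_eq_attach]
  rw [← Finset.sum_attach]
  refine Finset.sum_congr rfl fun p _ => ?_
  have hp := Finset.HasAntidiagonal.mem_antidiagonal.1 p.2
  have w : ∀ m, p.1.1 + p.1.2 = m → ENNReal.ofReal (z ^ m / (m.factorial : ℝ)) *
      ((p.1.1 + p.1.2).choose p.1.1 : ℕ) = c p.1.1 * c p.1.2 := by
    rintro _ rfl
    exact ofReal_poisson_weight_mul_choose hz _ _
  rw [← mul_assoc, w n hp]
  rfl

lemma ae_card_symLebesgue (d n : ℕ) : ∀ᵐ η ∂(symLebesgue d n), η.pts.card = n := by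
  have hm : MeasurableSet {η : FinConf d | η.pts.card = n} :=
    (measurable_conf_card measurable_id) (measurableSet_singleton n)
  exact (ae_map_iff (measurable_confOfTuple d n).aemeasurable hm).2
    (Filter.Eventually.of_forall fun v => by simp [confOfTuple])

/-- The Mecke formula for the Lebesgue–Poisson measure. -/
lemma lintegral_sum_erase (hd : 1 ≤ d) {z : ℝ} (hz : 0 ≤ z)
    {f : Site d → FinConf d → ℝ≥0∞} (hf : Measurable (Function.uncurry f)) :
    ∫⁻ η, ∑ x ∈ η.pts, f x ⟨η.pts.erase x⟩ ∂(lebesguePoisson d z) =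
      ENNReal.ofReal z * ∫⁻ x, ∫⁻ η, f x η ∂(lebesguePoisson d z) := by
  -- Removing one point is a splitting whose first part is a singleton. In the splitting formula
  -- only the one-point component survives, and its weight is `z`.
  let F : FinConf d → FinConf d → ℝ≥0∞ := fun ξ ζ =>
    if ξ.pts.card = 1 then ∑ x ∈ ξ.pts, f x ζ else 0
  have hF : Measurable (Function.uncurry F) := by
    refine Measurable.ite ?_ ?_ measurable_const
    · exact (measurable_conf_card measurable_fst) (measurableSet_singleton 1)
    · exact measurable_sum_pts (f := fun (p : FinConf d × FinConf d) x => f x p.2) measurable_fst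
        (hf.comp (measurable_snd.prodMk measurable_fst.snd))
  have hL : ∀ η : FinConf d, ∑ s ∈ η.pts.powerset, F ⟨s⟩ ⟨η.pts \ s⟩ =
      ∑ x ∈ η.pts, f x ⟨η.pts.erase x⟩ := by
    intro η
    simp only [F]
    rw [← Finset.sum_filter, ← Finset.powersetCard_eq_filter, Finset.powersetCard_one,
      Finset.sum_map]
    simp [Finset.sdiff_singleton_eq_erase]
  have hg : Measurable fun x => ∫⁻ ζ, f x ζ ∂(lebesguePoisson d z) := hf.lintegral_prod_right'
  have hin : ∀ ξ, ∫⁻ ζ, F ξ ζ ∂(lebesguePoisson d z) =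
      if ξ.pts.card = 1 then ∑ x ∈ ξ.pts, ∫⁻ ζ, f x ζ ∂(lebesguePoisson d z) else 0 := by
    intro ξ
    by_cases h : ξ.pts.card = 1
    · simp only [F, h, if_true]
      exact lintegral_finsetSum _ fun x _ => hf.comp measurable_prodMk_left
    · simp [F, h]
  have hGm : Measurable fun ξ => ∫⁻ ζ, F ξ ζ ∂(lebesguePoisson d z) := hF.lintegral_prod_right'
  simp_rw [← hL]
  rw [lintegral_sum_powerset hd hz hF, lintegral_lebesguePoisson, tsum_eq_single 1]
  · rw [lintegral_symLebesgue hd (ι := Unit) (by simp) hGm]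
    simp only [pow_one, Nat.factorial_one, Nat.cast_one, div_one]
    congr 1
    rw [← (volume_preserving_funUnique Unit (Site d)).lintegral_comp hg]
    refine lintegral_congr fun v => ?_
    rw [hin]
    simp [MeasurableEquiv.funUnique]
  · intro n hn
    have : (fun ξ => ∫⁻ ζ, F ξ ζ ∂(lebesguePoisson d z)) =ᵐ[symLebesgue d n] fun _ => 0 := by
      filter_upwards [ae_card_symLebesgue d n] with ξ hξ
      rw [hin, if_neg (by omega)]
    rw [lintegral_congr_ae this]
    simp

/-- For fixed `ξ`, the Mecke formula gives the number of points of `η` lying in `ξ` the integral `z`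
times the volume of the finite set `ξ`, which is zero. -/
lemma ae_disjoint_lebesguePoisson (hd : 1 ≤ d) {z : ℝ} (hz : 0 ≤ z) :
    ∀ᵐ p ∂((lebesguePoisson d z).prod (lebesguePoisson d z)), Disjoint p.1.pts p.2.pts := by
  have := site_nontrivial hd
  refine (Measure.measure_prod_null measurableSet_conf_disjoint.compl).2 ?_
  refine Filter.Eventually.of_forall fun ξ => ?_
  simp only [Pi.zero_apply]
  have hx : MeasurableSet {x : Site d | x ∈ ξ.pts} := ξ.pts.finite_toSet.measurableSet
  let f : Site d → FinConf d → ℝ≥0∞ := fun x _ => {x : Site d | x ∈ ξ.pts}.indicator 1 x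
  have hf : Measurable (Function.uncurry f) := (measurable_one.indicator hx).comp measurable_fst
  have hM := lintegral_sum_erase hd hz hf
  have h0 : ∫⁻ x, ∫⁻ η, f x η ∂(lebesguePoisson d z) = 0 := by
    have : volume {x : Site d | x ∈ ξ.pts} = 0 := ξ.pts.finite_toSet.measure_zero _
    have hae : (fun x => ∫⁻ η, f x η ∂(lebesguePoisson d z)) =ᵐ[volume] fun _ => 0 := by
      filter_upwards [compl_mem_ae_iff.2 this] with x hx
      simp only [mem_compl_iff, mem_ofPred_eq] at hx
      simp [f, hx]
    rw [lintegral_congr_ae hae, lintegral_zero]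
  rw [h0, mul_zero] at hM
  have hms : Measurable fun η : FinConf d => ∑ x ∈ η.pts, f x ⟨η.pts.erase x⟩ :=
    measurable_sum_pts (f := fun (_ : FinConf d) x => f x ⟨∅⟩) measurable_id
      (hf.comp (measurable_snd.prodMk (measurable_const (a := (⟨∅⟩ : FinConf d)))))
  have hz' := (lintegral_eq_zero_iff hms).1 hM
  refine measure_mono_null (fun η hη => ?_) hz'
  simp only [mem_preimage, mem_compl_iff, mem_ofPred_eq, Finset.disjoint_left, not_forall,
    not_not] at hη
  obtain ⟨x, hx1, hx2⟩ := hη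
  simp only [mem_compl_iff, mem_ofPred_eq, Pi.zero_apply]
  intro h
  have := (Finset.sum_eq_zero_iff.1 h) x hx2
  simp [f, hx1] at this

end integrals

/-! ### Operators in `L¹` bounded by a multiplication operator -/

section weightedOperators

variable {α : Type*} [MeasurableSpace α] {μ : Measure α}

/-- The maximal domain `{G : N G ∈ L¹}` of the operator of multiplication by `N` in `L¹`. -/
def mulDomain (μ : Measure α) (N : α → ℝ) : Submodule ℝ (Lp ℝ 1 μ) where
  carrier := {G | MemLp (fun a => N a * G a) 1 μ}
  add_mem' {G G'} hG hG' := by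
    refine (memLp_congr_ae ?_).1 (MemLp.add hG hG')
    filter_upwards [Lp.coeFn_add G G'] with a ha
    exact (mul_add _ _ _).symm.trans (congrArg (N a * ·) ha.symm)
  zero_mem' := by
    refine (memLp_congr_ae ?_).1 (MemLp.zero (ε := ℝ))
    filter_upwards [Lp.coeFn_zero ℝ 1 μ] with a ha
    exact (mul_zero _).symm.trans (congrArg (N a * ·) ha.symm)
  smul_mem' c G hG := by
    refine (memLp_congr_ae ?_).1 (MemLp.const_smul hG c)
    filter_upwards [Lp.coeFn_smul c G] with a ha
    exact (mul_left_comm _ _ _).trans (congrArg (N a * ·) ha.symm)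

lemma mem_mulDomain {N : α → ℝ} {G : Lp ℝ 1 μ} :
    G ∈ mulDomain μ N ↔ MemLp (fun a => N a * G a) 1 μ := Iff.rfl

/-- The truncations of `G` to the sets where a measurable version of `N` is at most `k` in absolute
value lie in the domain and converge to `G` by dominated convergence. -/
lemma dense_mulDomain {N : α → ℝ} (hN : AEMeasurable N μ) :
    Dense (mulDomain μ N : Set (Lp ℝ 1 μ)) := by
  intro G
  set N' := hN.mk N with hN'
  have hN'm : Measurable N' := hN.measurable_mk
  let A : ℕ → Set α := fun k => {a | |N' a| ≤ k}
  have hA : ∀ k, MeasurableSet (A k) := fun k => measurableSet_le hN'm.norm measurable_const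
  have hmem : ∀ k, MemLp ((A k).indicator G) 1 μ := fun k => (Lp.memLp G).indicator (hA k)
  have hGm : ∀ k, AEStronglyMeasurable ((A k).indicator G) μ := fun k =>
    (hmem k).aestronglyMeasurable
  refine mem_closure_of_tendsto (f := fun k => (hmem k).toLp) (b := Filter.atTop) ?_ ?_
  · rw [Lp.tendsto_Lp_iff_tendsto_eLpNorm']
    have h0 : Filter.Tendsto (fun k => ∫⁻ a, ‖(A k).indicator G a - G a‖ₑ ∂μ) Filter.atTop
        (nhds (∫⁻ _, 0 ∂μ)) := by
      refine tendsto_lintegral_of_dominated_convergence' (fun a => ‖G a‖ₑ) (fun k => ?_)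
        (fun k => ?_) ?_ ?_
      · exact ((hGm k).sub (Lp.aestronglyMeasurable G)).enorm
      · refine Filter.Eventually.of_forall fun a => ?_
        by_cases ha : a ∈ A k <;> simp [ha]
      · have := (Lp.memLp G).eLpNorm_ne_top
        rwa [eLpNorm_one_eq_lintegral_enorm] at this
      · refine Filter.Eventually.of_forall fun a => ?_
        obtain ⟨K, hK⟩ := exists_nat_ge |N' a|
        refine tendsto_const_nhds.congr' ?_
        filter_upwards [Filter.eventually_ge_atTop K] with k hk
        have : a ∈ A k := hK.trans (by exact_mod_cast hk)
        simp [this]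
    rw [lintegral_zero] at h0
    refine h0.congr fun k => ?_
    rw [eLpNorm_one_eq_lintegral_enorm]
    refine lintegral_congr_ae ?_
    filter_upwards [(hmem k).coeFn_toLp] with a ha
    simp [ha]
  · refine Filter.Eventually.of_forall fun k => ?_
    refine mem_mulDomain.2 (MemLp.of_le_mul (c := k) (Lp.memLp G) ?_ ?_)
    · exact hN.aestronglyMeasurable.mul (Lp.aestronglyMeasurable _)
    · filter_upwards [(hmem k).coeFn_toLp, hN.ae_eq_mk] with a ha haN
      rw [ha, norm_mul, haN]
      by_cases haA : a ∈ A k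
      · simp only [haA, indicator_of_mem]
        exact mul_le_mul_of_nonneg_right haA (norm_nonneg _)
      · simp only [haA, not_false_eq_true, indicator_of_notMem, norm_zero, mul_zero]
        positivity

/-- A linear operation on functions, defined where `Conv` holds and dominated in `L¹` by the
multiplication by `N`, induces an operator in `L¹` with domain `{G : N G ∈ L¹}`. -/
theorem exists_linearPMap_of_le_mul {N : α → ℝ} (hN : AEMeasurable N μ)
    (T : (α → ℝ) → α → ℝ) (Conv : (α → ℝ) → α → Prop)
    (hcongr : ∀ g g' : α → ℝ, g =ᵐ[μ] g' →
      ∀ᵐ a ∂μ, (Conv g a → Conv g' a) ∧ T g a = T g' a)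
    (hmeas : ∀ g, Measurable g → Measurable (T g))
    (hle : ∀ g, Measurable g → ∫⁻ a, ‖T g a‖ₑ ∂μ ≤ ∫⁻ a, ‖N a * g a‖ₑ ∂μ)
    (hconv : ∀ g, Measurable g → ∫⁻ a, ‖N a * g a‖ₑ ∂μ < ∞ → ∀ᵐ a ∂μ, Conv g a)
    (hadd : ∀ g g' a, Conv g a → Conv g' a → T (g + g') a = T g a + T g' a)
    (hsmul : ∀ (c : ℝ) g a, T (c • g) a = c * T g a) :
    ∃ L : Lp ℝ 1 μ →ₗ.[ℝ] Lp ℝ 1 μ,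
      (Dense (L.domain : Set (Lp ℝ 1 μ)) ∧
        ∀ G : Lp ℝ 1 μ, G ∈ L.domain ↔ MemLp (fun a => N a * G a) 1 μ) ∧
      ∀ (G : L.domain) (g : α → ℝ), g =ᵐ[μ] (G : Lp ℝ 1 μ) →
        (∀ᵐ a ∂μ, Conv g a) ∧ (L G : α → ℝ) =ᵐ[μ] T g ∧ ‖L G‖ ≤ ∫ a, |N a * g a| ∂μ := by
  have hfin : ∀ G : mulDomain μ N, ∫⁻ a, ‖N a * (G : Lp ℝ 1 μ) a‖ₑ ∂μ < ∞ := fun G => by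
    rw [← eLpNorm_one_eq_lintegral_enorm]
    exact (mem_mulDomain.1 G.2).eLpNorm_lt_top
  have hGm : ∀ G : Lp ℝ 1 μ, Measurable G := fun G => (Lp.stronglyMeasurable G).measurable
  have hT : ∀ G : mulDomain μ N, MemLp (T (G : Lp ℝ 1 μ)) 1 μ := fun G =>
    ⟨(hmeas _ (hGm _)).aestronglyMeasurable, by
      rw [eLpNorm_one_eq_lintegral_enorm]
      exact (hle _ (hGm _)).trans_lt (hfin G)⟩
  have hC : ∀ G : mulDomain μ N, ∀ᵐ a ∂μ, Conv (G : Lp ℝ 1 μ) a := fun G =>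
    hconv _ (hGm _) (hfin G)
  -- The operation is applied to the measurable representative of the class; `hcongr` carries the
  -- result to every other one, and additivity is used only where both terms converge.
  let L : Lp ℝ 1 μ →ₗ.[ℝ] Lp ℝ 1 μ :=
    { domain := mulDomain μ N
      toFun :=
        { toFun := fun G => (hT G).toLp
          map_add' := fun G G' => by
            rw [← MemLp.toLp_add]
            refine MemLp.toLp_congr _ _ ?_
            filter_upwards [hcongr _ _ (Lp.coeFn_add (G : Lp ℝ 1 μ) G'), hC G, hC G']
              with a h1 h2 h3
            exact h1.2.trans (hadd _ _ _ h2 h3)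
          map_smul' := fun c G => by
            rw [RingHom.id_apply, ← MemLp.toLp_const_smul]
            refine MemLp.toLp_congr _ _ ?_
            filter_upwards [hcongr _ _ (Lp.coeFn_smul c (G : Lp ℝ 1 μ))] with a h1
            exact h1.2.trans (hsmul _ _ _) } }
  refine ⟨L, ⟨dense_mulDomain hN, fun G => mem_mulDomain⟩, fun G g hg => ⟨?_, ?_, ?_⟩⟩
  · filter_upwards [hcongr _ _ hg.symm, hC G] with a h1 h2
    exact h1.1 h2
  · filter_upwards [hcongr _ _ hg.symm, (hT G).coeFn_toLp] with a h1 h2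
    exact h2.trans h1.2
  · have h1 : ∫ a, |N a * g a| ∂μ = ∫ a, ‖N a * (G : Lp ℝ 1 μ) a‖ ∂μ := by
      refine integral_congr_ae ?_
      filter_upwards [hg] with a ha
      rw [ha, Real.norm_eq_abs]
    rw [h1, integral_norm_eq_lintegral_enorm (mem_mulDomain.1 G.2).aestronglyMeasurable]
    change ‖(hT G).toLp‖ ≤ _
    rw [Lp.norm_toLp, eLpNorm_one_eq_lintegral_enorm]
    exact ENNReal.toReal_mono (hfin G).ne (hle _ (hGm _))

end weightedOperators

/-! ### Pairs of configurations -/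

section pairs

open scoped Classical

variable {d : ℕ}

/-- Pairs of finite configurations, not necessarily disjoint. -/
abbrev ConfPair (d : ℕ) : Type := FinConf d × FinConf d

/-- The points with mark `b`, where `true` stands for `+` and `false` for `-`. -/
def ConfPair.pts (b : Bool) (p : ConfPair d) : Finset (Site d) :=
  cond b p.1.pts p.2.pts

/-- Removal of a point with mark `b`. -/
noncomputable def ConfPair.remove (b : Bool) (u : Site d) (p : ConfPair d) : ConfPair d :=
  cond b (⟨p.1.pts.erase u⟩, p.2) (p.1, ⟨p.2.pts.erase u⟩)

/-- Addition of a point with mark `b`. -/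
noncomputable def ConfPair.add (b : Bool) (u : Site d) (p : ConfPair d) : ConfPair d :=
  cond b (⟨insert u p.1.pts⟩, p.2) (p.1, ⟨insert u p.2.pts⟩)

/-- The componentwise difference. -/
noncomputable def ConfPair.diff (p q : ConfPair d) : ConfPair d :=
  (⟨p.1.pts \ q.1.pts⟩, ⟨p.2.pts \ q.2.pts⟩)

lemma ConfPair.add_remove {b : Bool} {u : Site d} {p : ConfPair d} (h : u ∈ p.pts b) :
    (p.remove b u).add b u = p := by
  cases b <;> simp_all [ConfPair.pts, ConfPair.remove, ConfPair.add, Finset.insert_erase]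

section measurability

variable {α : Type*} [MeasurableSpace α]

lemma measurable_pair_remove (b : Bool) {u : α → Site d} {p : α → ConfPair d}
    (hu : Measurable u) (hp : Measurable p) : Measurable fun a => (p a).remove b (u a) := by
  cases b
  · exact hp.fst.prodMk (measurable_conf_erase hu hp.snd)
  · exact (measurable_conf_erase hu hp.fst).prodMk hp.snd

lemma measurable_pair_add (b : Bool) {u : α → Site d} {p : α → ConfPair d}
    (hu : Measurable u) (hp : Measurable p) : Measurable fun a => (p a).add b (u a) := by
  cases b
  · exact hp.fst.prodMk (measurable_conf_insert hu hp.snd)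
  · exact (measurable_conf_insert hu hp.fst).prodMk hp.snd

lemma measurable_pair_diff {p q : α → ConfPair d} (hp : Measurable p) (hq : Measurable q) :
    Measurable fun a => (p a).diff (q a) :=
  (measurable_conf_sdiff hp.fst hq.fst).prodMk (measurable_conf_sdiff hp.snd hq.snd)

lemma measurable_sum_pair_pts (b : Bool) {p : α → ConfPair d} (hp : Measurable p)
    {f : α → Site d → ℝ≥0∞} (hf : Measurable (Function.uncurry f)) :
    Measurable fun a => ∑ u ∈ (p a).pts b, f a u := by
  cases b
  · exact measurable_sum_pts hp.snd hf
  · exact measurable_sum_pts hp.fst hf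

lemma measurable_sum_pair_pts_real (b : Bool) {p : α → ConfPair d} (hp : Measurable p)
    {f : α → Site d → ℝ} (hf : Measurable (Function.uncurry f)) :
    Measurable fun a => ∑ u ∈ (p a).pts b, f a u := by
  cases b
  · exact measurable_sum_pts_real hp.snd hf
  · exact measurable_sum_pts_real hp.fst hf

end measurability

/-- The sum over all pairs of subconfigurations. -/
def sumSub {M : Type*} [AddCommMonoid M] (p : ConfPair d) (f : ConfPair d → M) : M :=
  ∑ s ∈ p.1.pts.powerset, ∑ t ∈ p.2.pts.powerset, f (⟨s⟩, ⟨t⟩)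

lemma measurable_sumSub {α : Type*} [MeasurableSpace α] {p : α → ConfPair d} (hp : Measurable p)
    {f : α → ConfPair d → ℝ≥0∞} (hf : Measurable (Function.uncurry f)) :
    Measurable fun a => sumSub (p a) (f a) := by
  refine measurable_sum_powerset
    (f := fun a ξ => ∑ t ∈ (p a).2.pts.powerset, f a (ξ, ⟨t⟩)) hp.fst ?_
  exact measurable_sum_powerset (f := fun (q : α × FinConf d) ζ => f q.1 (q.2, ζ))
    (hp.comp measurable_fst).snd
    (hf.comp (measurable_fst.fst.prodMk (measurable_fst.snd.prodMk measurable_snd)))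

lemma measurable_sumSub_real {α : Type*} [MeasurableSpace α] {p : α → ConfPair d}
    (hp : Measurable p) {f : α → ConfPair d → ℝ} (hf : Measurable (Function.uncurry f)) :
    Measurable fun a => sumSub (p a) (f a) := by
  refine measurable_sum_powerset_real
    (f := fun a ξ => ∑ t ∈ (p a).2.pts.powerset, f a (ξ, ⟨t⟩)) hp.fst ?_
  exact measurable_sum_powerset_real (f := fun (q : α × FinConf d) ζ => f q.1 (q.2, ζ))
    (hp.comp measurable_fst).snd
    (hf.comp (measurable_fst.fst.prodMk (measurable_fst.snd.prodMk measurable_snd)))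

/-- The product of two Lebesgue–Poisson measures on pairs that need not be disjoint. -/
noncomputable def pairMeasure (d : ℕ) (z : ℝ) : Measure (ConfPair d) :=
  (lebesguePoisson d z).prod (lebesguePoisson d z)

instance pairMeasure_sFinite (d : ℕ) (z : ℝ) : SFinite (pairMeasure d z) := by
  unfold pairMeasure
  infer_instance

lemma lintegral_sumSub (hd : 1 ≤ d) {z : ℝ} (hz : 0 ≤ z)
    {H : ConfPair d → ConfPair d → ℝ≥0∞} (hH : Measurable (Function.uncurry H)) :
    ∫⁻ η, sumSub η (fun ξ => H ξ (η.diff ξ)) ∂(pairMeasure d z) =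
      ∫⁻ ξ, ∫⁻ ζ, H ξ ζ ∂(pairMeasure d z) ∂(pairMeasure d z) := by
  have hm : Measurable fun η : ConfPair d => sumSub η (fun ξ => H ξ (η.diff ξ)) :=
    measurable_sumSub (f := fun η ξ => H ξ (η.diff ξ)) measurable_id
      (hH.comp (measurable_snd.prodMk (measurable_pair_diff measurable_fst measurable_snd)))
  have hm2 : Measurable fun ξ => ∫⁻ ζ, H ξ ζ ∂(pairMeasure d z) := hH.lintegral_prod_right'
  have hin : ∀ η1 : FinConf d, ∫⁻ η2, sumSub (η1, η2) (fun ξ => H ξ (ConfPair.diff (η1, η2) ξ)) ∂(lebesguePoisson d z) =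
      ∑ s ∈ η1.pts.powerset, ∫⁻ ξ2, ∫⁻ ζ2, H (⟨s⟩, ξ2) (⟨η1.pts \ s⟩, ζ2) ∂(lebesguePoisson d z)
          ∂(lebesguePoisson d z) := by
    intro η1
    have hHs : ∀ s, Measurable (Function.uncurry fun ξ2 ζ2 : FinConf d =>
        H (⟨s⟩, ξ2) (⟨η1.pts \ s⟩, ζ2)) := fun s =>
      hH.comp ((measurable_const.prodMk measurable_fst).prodMk
        (measurable_const.prodMk measurable_snd))
    simp only [sumSub]
    rw [lintegral_finsetSum]
    · refine Finset.sum_congr rfl fun s _ => ?_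
      exact lintegral_sum_powerset hd hz (hHs s)
    · intro s _
      exact measurable_sum_powerset
        (f := fun (η2 ξ2 : FinConf d) => H (⟨s⟩, ξ2) (⟨η1.pts \ s⟩, ⟨η2.pts \ ξ2.pts⟩))
        measurable_id ((hHs s).comp (measurable_snd.prodMk
          (measurable_conf_sdiff measurable_fst measurable_snd)))
  have hF : Measurable (Function.uncurry fun ξ1 ζ1 : FinConf d =>
      ∫⁻ ξ2, ∫⁻ ζ2, H (ξ1, ξ2) (ζ1, ζ2) ∂(lebesguePoisson d z)
          ∂(lebesguePoisson d z)) := by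
    refine Measurable.lintegral_prod_right'
      (f := fun q : (FinConf d × FinConf d) × FinConf d =>
        ∫⁻ ζ2, H (q.1.1, q.2) (q.1.2, ζ2) ∂(lebesguePoisson d z)) ?_
    refine Measurable.lintegral_prod_right'
      (f := fun q : ((FinConf d × FinConf d) × FinConf d) × FinConf d =>
        H (q.1.1.1, q.1.2) (q.1.1.2, q.2)) ?_
    exact hH.comp ((measurable_fst.fst.fst.prodMk measurable_fst.snd).prodMk
      (measurable_fst.fst.snd.prodMk measurable_snd))
  unfold pairMeasure at *
  rw [lintegral_prod _ hm.aemeasurable, lintegral_prod _ hm2.aemeasurable]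
  simp_rw [hin]
  rw [lintegral_sum_powerset hd hz hF]
  refine lintegral_congr fun ξ1 => ?_
  -- The one-component formula has been applied in each component; it remains to exchange `ζ1` and
  -- `ξ2`.
  rw [lintegral_lintegral_swap]
  · refine lintegral_congr fun ξ2 => ?_
    exact (lintegral_prod (H (ξ1, ξ2)) (hH.comp measurable_prodMk_left).aemeasurable).symm
  · refine Measurable.aemeasurable ?_
    refine Measurable.lintegral_prod_right'
      (f := fun q : (FinConf d × FinConf d) × FinConf d => H (ξ1, q.1.2) (q.1.1, q.2)) ?_
    exact hH.comp ((measurable_const.prodMk measurable_fst.snd).prodMk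
      (measurable_fst.fst.prodMk measurable_snd))

/-- The Mecke formula in one component, the other being a parameter. The constant is the same for
both marks, so jumps that change the mark produce no extra factor. -/
lemma lintegral_sum_remove (hd : 1 ≤ d) {z : ℝ} (hz : 0 ≤ z) (b : Bool)
    {f : Site d → ConfPair d → ℝ≥0∞} (hf : Measurable (Function.uncurry f)) :
    ∫⁻ η, ∑ u ∈ η.pts b, f u (η.remove b u) ∂(pairMeasure d z) =
      ENNReal.ofReal z * ∫⁻ u, ∫⁻ η, f u η ∂(pairMeasure d z) := by
  have hm : Measurable fun η : ConfPair d => ∑ u ∈ η.pts b, f u (η.remove b u) :=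
    measurable_sum_pair_pts b (f := fun η u => f u (η.remove b u)) measurable_id
      (hf.comp (measurable_snd.prodMk (measurable_pair_remove b measurable_snd measurable_fst)))
  have hfu : ∀ u, Measurable (f u) := fun u => hf.comp measurable_prodMk_left
  unfold pairMeasure at *
  cases b
  · rw [lintegral_prod _ hm.aemeasurable]
    have h1 : ∀ η1 : FinConf d, ∫⁻ η2, ∑ u ∈ ConfPair.pts false (η1, η2),
        f u (ConfPair.remove false u (η1, η2)) ∂(lebesguePoisson d z) =
        ENNReal.ofReal z * ∫⁻ u, ∫⁻ η2, f u (η1, η2) ∂(lebesguePoisson d z) := fun η1 =>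
      lintegral_sum_erase hd hz (f := fun u η2 => f u (η1, η2))
        (hf.comp (measurable_fst.prodMk (measurable_const.prodMk measurable_snd)))
    have h2 : Measurable (Function.uncurry fun (η1 : FinConf d) (u : Site d) =>
        ∫⁻ η2, f u (η1, η2) ∂(lebesguePoisson d z)) := by
      refine Measurable.lintegral_prod_right'
        (f := fun q : (FinConf d × Site d) × FinConf d => f q.1.2 (q.1.1, q.2)) ?_
      exact hf.comp (measurable_fst.snd.prodMk (measurable_fst.fst.prodMk measurable_snd))
    have h3 : Measurable fun η1 => ∫⁻ u, ∫⁻ η2, f u (η1, η2) ∂(lebesguePoisson d z) :=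
      h2.lintegral_prod_right'
    simp_rw [h1]
    rw [lintegral_const_mul _ h3, lintegral_lintegral_swap h2.aemeasurable]
    congr 1
    refine lintegral_congr fun u => ?_
    rw [lintegral_prod _ (hfu u).aemeasurable]
  · rw [lintegral_prod_symm _ hm.aemeasurable]
    have h1 : ∀ η2 : FinConf d, ∫⁻ η1, ∑ u ∈ ConfPair.pts true (η1, η2),
        f u (ConfPair.remove true u (η1, η2)) ∂(lebesguePoisson d z) =
        ENNReal.ofReal z * ∫⁻ u, ∫⁻ η1, f u (η1, η2) ∂(lebesguePoisson d z) := fun η2 =>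
      lintegral_sum_erase hd hz (f := fun u η1 => f u (η1, η2))
        (hf.comp (measurable_fst.prodMk (measurable_snd.prodMk measurable_const)))
    have h2 : Measurable (Function.uncurry fun (η2 : FinConf d) (u : Site d) =>
        ∫⁻ η1, f u (η1, η2) ∂(lebesguePoisson d z)) := by
      refine Measurable.lintegral_prod_right'
        (f := fun q : (FinConf d × Site d) × FinConf d => f q.1.2 (q.2, q.1.1)) ?_
      exact hf.comp (measurable_fst.snd.prodMk (measurable_snd.prodMk measurable_fst.fst))
    have h3 : Measurable fun η2 => ∫⁻ u, ∫⁻ η1, f u (η1, η2) ∂(lebesguePoisson d z) :=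
      h2.lintegral_prod_right'
    simp_rw [h1]
    rw [lintegral_const_mul _ h3, lintegral_lintegral_swap h2.aemeasurable]
    congr 1
    refine lintegral_congr fun u => ?_
    rw [lintegral_prod_symm _ (hfu u).aemeasurable]

end pairs

/-! ### Jumps -/

section jumps

open scoped Classical

variable {d : ℕ}

/-- The arguments of a jump kernel: start, target, environment, interaction. -/
abbrev JumpVars (d : ℕ) : Type := Site d × Site d × ConfPair d × ConfPair d

/-- The total rate `∑_u ∫ ∫ Φ(u, u', ξ ∖ u, ζ) du' dζ` over the points `u` of `ξ` with mark `b`. -/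
noncomputable def exitWeight (z : ℝ) (b : Bool) (Φ : JumpVars d → ℝ≥0∞) (ξ : ConfPair d) : ℝ≥0∞ :=
  ∑ u ∈ ξ.pts b, ∫⁻ ζ, ∫⁻ u', Φ (u, u', ξ.remove b u, ζ) ∂volume ∂(pairMeasure d z)

/-- The jump kernel with start and target exchanged. -/
def reverseJump {M : Type*} (Φ : JumpVars d → M) : JumpVars d → M :=
  fun q => Φ (q.2.1, q.1, q.2.2)

lemma Measurable.reverseJump {M : Type*} [MeasurableSpace M] {Φ : JumpVars d → M}
    (hΦ : Measurable Φ) : Measurable (reverseJump Φ) :=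
  hΦ.comp (measurable_snd.fst.prodMk (measurable_fst.prodMk measurable_snd.snd))

lemma lintegral_sumSub_jump (hd : 1 ≤ d) {z : ℝ} (hz : 0 ≤ z) (a : Bool)
    {K : JumpVars d → ℝ≥0∞} (hK : Measurable K) :
    ∫⁻ η, sumSub η (fun ξ => ∑ u ∈ ξ.pts a, ∫⁻ u', K (u, u', ξ, η.diff ξ)) ∂(pairMeasure d z) =
      ∫⁻ ξ, ∑ u ∈ ξ.pts a, ∫⁻ ζ, ∫⁻ u', K (u, u', ξ, ζ) ∂volume ∂(pairMeasure d z)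
        ∂(pairMeasure d z) := by
  have hK1 : Measurable fun q : (ConfPair d × ConfPair d) × Site d =>
      ∫⁻ u', K (q.2, u', q.1.1, q.1.2) := by
    refine Measurable.lintegral_prod_right'
      (f := fun q : ((ConfPair d × ConfPair d) × Site d) × Site d =>
        K (q.1.2, q.2, q.1.1.1, q.1.1.2)) ?_
    exact hK.comp (measurable_fst.snd.prodMk (measurable_snd.prodMk
      (measurable_fst.fst.fst.prodMk measurable_fst.fst.snd)))
  rw [lintegral_sumSub hd hz (H := fun ξ ζ => ∑ u ∈ ξ.pts a, ∫⁻ u', K (u, u', ξ, ζ))]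
  · refine lintegral_congr fun ξ => ?_
    refine lintegral_finsetSum _ fun u _ => ?_
    exact hK1.comp ((measurable_const.prodMk measurable_id).prodMk measurable_const)
  · exact measurable_sum_pair_pts a (f := fun (q : ConfPair d × ConfPair d) u =>
      ∫⁻ u', K (u, u', q.1, q.2)) measurable_fst hK1

lemma measurable_lintegral_jump {z : ℝ} {K : JumpVars d → ℝ≥0∞} (hK : Measurable K) :
    Measurable fun q : Site d × ConfPair d =>
      ∫⁻ ζ, ∫⁻ u', K (q.1, u', q.2, ζ) ∂volume ∂(pairMeasure d z) := by
  refine Measurable.lintegral_prod_right' (f := fun r : (Site d × ConfPair d) × ConfPair d =>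
    ∫⁻ u', K (r.1.1, u', r.1.2, r.2)) ?_
  refine Measurable.lintegral_prod_right'
    (f := fun r : ((Site d × ConfPair d) × ConfPair d) × Site d =>
      K (r.1.1.1, r.2, r.1.1.2, r.1.2)) ?_
  exact hK.comp (measurable_fst.fst.fst.prodMk (measurable_snd.prodMk
    (measurable_fst.fst.snd.prodMk measurable_fst.snd)))

lemma measurable_exitWeight {z : ℝ} (b : Bool) {Φ : JumpVars d → ℝ≥0∞} (hΦ : Measurable Φ) :
    Measurable (exitWeight z b Φ) :=
  measurable_sum_pair_pts b (f := fun ξ u =>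
    ∫⁻ ζ, ∫⁻ u', Φ (u, u', ConfPair.remove b u ξ, ζ) ∂volume ∂(pairMeasure d z)) measurable_id
    ((measurable_lintegral_jump hΦ).comp
      (measurable_snd.prodMk (measurable_pair_remove b measurable_snd measurable_fst)))

lemma lintegral_stay (hd : 1 ≤ d) {z : ℝ} (hz : 0 ≤ z) (a : Bool)
    {Φ : JumpVars d → ℝ≥0∞} (hΦ : Measurable Φ) {G : ConfPair d → ℝ≥0∞} (hG : Measurable G) :
    ∫⁻ η, sumSub η (fun ξ => ∑ u ∈ ξ.pts a, ∫⁻ u', G ξ * Φ (u, u', ξ.remove a u, η.diff ξ))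
        ∂(pairMeasure d z) =
      ∫⁻ ξ, G ξ * exitWeight z a Φ ξ ∂(pairMeasure d z) := by
  have hΦ' : Measurable fun q : JumpVars d => Φ (q.1, q.2.1, q.2.2.1.remove a q.1, q.2.2.2) :=
    hΦ.comp (measurable_fst.prodMk (measurable_snd.fst.prodMk
      ((measurable_pair_remove a measurable_fst measurable_snd.snd.fst).prodMk
        measurable_snd.snd.snd)))
  rw [lintegral_sumSub_jump hd hz a
    (K := fun q => G q.2.2.1 * Φ (q.1, q.2.1, q.2.2.1.remove a q.1, q.2.2.2))
    ((hG.comp measurable_snd.snd.fst).mul hΦ')]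
  refine lintegral_congr fun ξ => ?_
  rw [exitWeight, Finset.mul_sum]
  refine Finset.sum_congr rfl fun u _ => ?_
  have h1 : Measurable (Function.uncurry fun (ζ : ConfPair d) (u' : Site d) =>
      Φ (u, u', ξ.remove a u, ζ)) :=
    hΦ.comp (measurable_const.prodMk (measurable_snd.prodMk
      (measurable_const.prodMk measurable_fst)))
  have h2 : Measurable fun ζ => ∫⁻ u', Φ (u, u', ξ.remove a u, ζ) := h1.lintegral_prod_right'
  rw [← lintegral_const_mul _ h2]
  refine lintegral_congr fun ζ => ?_
  have h3 : Measurable fun u' => Φ (u, u', ξ.remove a u, ζ) := h1.comp measurable_prodMk_left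
  exact lintegral_const_mul (μ := volume) (G ξ) h3

/-- The configuration after the jump becomes the variable of integration, and the former start point
is integrated out: Mecke for the mark `a`, exchange of start and target, Mecke backwards for the
mark `b`. Both uses give the factor `z`, so no division is needed. -/
lemma lintegral_arrive (hd : 1 ≤ d) {z : ℝ} (hz : 0 ≤ z) (a b : Bool)
    {Φ : JumpVars d → ℝ≥0∞} (hΦ : Measurable Φ) {G : ConfPair d → ℝ≥0∞} (hG : Measurable G) :
    ∫⁻ η, sumSub η (fun ξ => ∑ u ∈ ξ.pts a, ∫⁻ u',
          G ((ξ.remove a u).add b u') * Φ (u, u', ξ.remove a u, η.diff ξ)) ∂(pairMeasure d z) =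
      ∫⁻ ξ, G ξ * exitWeight z b (reverseJump Φ) ξ ∂(pairMeasure d z) := by
  let K : JumpVars d → ℝ≥0∞ := fun q => G (q.2.2.1.add b q.2.1) * Φ q
  have hK : Measurable K :=
    (hG.comp (measurable_pair_add b measurable_snd.fst measurable_snd.snd.fst)).mul hΦ
  have hK' : Measurable fun q : JumpVars d => K (q.1, q.2.1, q.2.2.1.remove a q.1, q.2.2.2) :=
    hK.comp (measurable_fst.prodMk (measurable_snd.fst.prodMk
      ((measurable_pair_remove a measurable_fst measurable_snd.snd.fst).prodMk
        measurable_snd.snd.snd)))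
  have hswap : ∫⁻ u, ∫⁻ ξ, ∫⁻ ζ, ∫⁻ u', K (u, u', ξ, ζ) ∂volume ∂(pairMeasure d z) ∂(pairMeasure d z) =
      ∫⁻ u, ∫⁻ ξ, ∫⁻ ζ, ∫⁻ u', reverseJump K (u, u', ξ, ζ) ∂volume ∂(pairMeasure d z)
        ∂(pairMeasure d z) := by
    have e1 : ∀ {K : JumpVars d → ℝ≥0∞}, Measurable K →
        ∫⁻ u, ∫⁻ ξ, ∫⁻ ζ, ∫⁻ u', K (u, u', ξ, ζ) ∂volume ∂(pairMeasure d z) ∂(pairMeasure d z) =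
        ∫⁻ u, ∫⁻ u', ∫⁻ ξ, ∫⁻ ζ, K (u, u', ξ, ζ) ∂(pairMeasure d z) ∂(pairMeasure d z) := by
      intro K hK
      refine lintegral_congr fun u => ?_
      have m1 : Measurable (Function.uncurry fun (ξ : ConfPair d) (u' : Site d) =>
          ∫⁻ ζ, K (u, u', ξ, ζ) ∂(pairMeasure d z)) := by
        refine Measurable.lintegral_prod_right'
          (f := fun r : (ConfPair d × Site d) × ConfPair d => K (u, r.1.2, r.1.1, r.2)) ?_
        exact hK.comp (measurable_const.prodMk (measurable_fst.snd.prodMk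
          (measurable_fst.fst.prodMk measurable_snd)))
      rw [← lintegral_lintegral_swap m1.aemeasurable]
      refine lintegral_congr fun ξ => ?_
      refine lintegral_lintegral_swap (Measurable.aemeasurable ?_)
      exact hK.comp (measurable_const.prodMk (measurable_snd.prodMk
        (measurable_const.prodMk measurable_fst)))
    rw [e1 hK, e1 hK.reverseJump, lintegral_lintegral_swap]
    · rfl
    · refine Measurable.aemeasurable ?_
      refine Measurable.lintegral_prod_right' (f := fun r : (Site d × Site d) × ConfPair d =>
        ∫⁻ ζ, K (r.1.1, r.1.2, r.2, ζ) ∂(pairMeasure d z)) ?_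
      refine Measurable.lintegral_prod_right'
        (f := fun r : ((Site d × Site d) × ConfPair d) × ConfPair d =>
          K (r.1.1.1, r.1.1.2, r.1.2, r.2)) ?_
      exact hK.comp (measurable_fst.fst.fst.prodMk (measurable_fst.fst.snd.prodMk
        (measurable_fst.snd.prodMk measurable_snd)))
  rw [lintegral_sumSub_jump hd hz a hK',
    lintegral_sum_remove hd hz a
      (f := fun u ξ => ∫⁻ ζ, ∫⁻ u', K (u, u', ξ, ζ) ∂volume ∂(pairMeasure d z))
      (measurable_lintegral_jump hK), hswap,
    ← lintegral_sum_remove hd hz b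
      (f := fun u ξ => ∫⁻ ζ, ∫⁻ u', reverseJump K (u, u', ξ, ζ) ∂volume ∂(pairMeasure d z))
      (measurable_lintegral_jump hK.reverseJump)]
  refine lintegral_congr fun ξ => ?_
  rw [exitWeight, Finset.mul_sum]
  refine Finset.sum_congr rfl fun u hu => ?_
  have h1 : Measurable (Function.uncurry fun (ζ : ConfPair d) (u' : Site d) =>
      reverseJump Φ (u, u', ξ.remove b u, ζ)) :=
    hΦ.reverseJump.comp (measurable_const.prodMk (measurable_snd.prodMk
      (measurable_const.prodMk measurable_fst)))
  have h2 : Measurable fun ζ => ∫⁻ u', reverseJump Φ (u, u', ξ.remove b u, ζ) :=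
    h1.lintegral_prod_right'
  rw [← lintegral_const_mul _ h2]
  refine lintegral_congr fun ζ => ?_
  have h3 : Measurable fun u' => reverseJump Φ (u, u', ξ.remove b u, ζ) :=
    h1.comp measurable_prodMk_left
  rw [← lintegral_const_mul _ h3]
  refine lintegral_congr fun u' => ?_
  -- Here `u` is the arrival point and belongs to `ξ`; removing it and adding it back lets `G` be
  -- evaluated at `ξ` itself.
  simp only [K, reverseJump, ConfPair.add_remove hu]

end jumps

/-! ### The jump operators -/

section jumpOperators

open scoped Classical

variable {d : ℕ}

/-- The integrand of the jump operator with jumps from mark `a` to mark `b`. -/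
noncomputable def jumpTerm (a b : Bool) (Φ : JumpVars d → ℝ) (G : ConfPair d → ℝ)
    (η ξ : ConfPair d) (u u' : Site d) : ℝ :=
  (G ((ξ.remove a u).add b u') - G ξ) * Φ (u, u', ξ.remove a u, η.diff ξ)

/-- The jump operator with jumps from mark `a` to mark `b`. -/
noncomputable def jumpOp (a b : Bool) (Φ : JumpVars d → ℝ) (G : ConfPair d → ℝ)
    (η : ConfPair d) : ℝ :=
  sumSub η fun ξ => ∑ u ∈ ξ.pts a, ∫ u', jumpTerm a b Φ G η ξ u u'

/-- Absolute convergence of all the integrals in `jumpOp`. -/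
def JumpConverges (a b : Bool) (Φ : JumpVars d → ℝ) (G : ConfPair d → ℝ)
    (η : ConfPair d) : Prop :=
  ∀ s ⊆ η.1.pts, ∀ t ⊆ η.2.pts, ∀ u ∈ ConfPair.pts a (⟨s⟩, ⟨t⟩),
    Integrable (jumpTerm a b Φ G η (⟨s⟩, ⟨t⟩) u)

lemma sumSub_congr {M : Type*} [AddCommMonoid M] {η : ConfPair d} {f g : ConfPair d → M}
    (h : ∀ s ⊆ η.1.pts, ∀ t ⊆ η.2.pts, f (⟨s⟩, ⟨t⟩) = g (⟨s⟩, ⟨t⟩)) :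
    sumSub η f = sumSub η g :=
  Finset.sum_congr rfl fun s hs => Finset.sum_congr rfl fun t ht =>
    h s (Finset.mem_powerset.1 hs) t (Finset.mem_powerset.1 ht)

lemma sumSub_add {M : Type*} [AddCommMonoid M] (η : ConfPair d) (f g : ConfPair d → M) :
    sumSub η (fun ξ => f ξ + g ξ) = sumSub η f + sumSub η g := by
  simp [sumSub, Finset.sum_add_distrib]

lemma le_sumSub {η : ConfPair d} (f : ConfPair d → ℝ≥0∞) {s t : Finset (Site d)}
    (hs : s ⊆ η.1.pts) (ht : t ⊆ η.2.pts) : f (⟨s⟩, ⟨t⟩) ≤ sumSub η f :=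
  (Finset.single_le_sum (f := fun t => f (⟨s⟩, ⟨t⟩)) (fun _ _ => zero_le)
    (Finset.mem_powerset.2 ht)).trans
    (Finset.single_le_sum (f := fun s => ∑ t ∈ η.2.pts.powerset, f (⟨s⟩, ⟨t⟩))
      (fun _ _ => zero_le) (Finset.mem_powerset.2 hs))

lemma sumSub_mono {η : ConfPair d} {f g : ConfPair d → ℝ≥0∞} (h : ∀ ξ, f ξ ≤ g ξ) :
    sumSub η f ≤ sumSub η g :=
  Finset.sum_le_sum fun _ _ => Finset.sum_le_sum fun _ _ => h _

lemma enorm_sumSub_le (η : ConfPair d) (f : ConfPair d → ℝ) :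
    ‖sumSub η f‖ₑ ≤ sumSub η fun ξ => ‖f ξ‖ₑ :=
  (enorm_sum_le _ _).trans (Finset.sum_le_sum fun _ _ => enorm_sum_le _ _)

section measurability

variable {α : Type*} [MeasurableSpace α] (a b : Bool) {Φ : JumpVars d → ℝ} {G : ConfPair d → ℝ}

lemma measurable_jumpTerm (hΦ : Measurable Φ) (hG : Measurable G) {η ξ : α → ConfPair d}
    {u u' : α → Site d} (hη : Measurable η) (hξ : Measurable ξ) (hu : Measurable u)
    (hu' : Measurable u') :
    Measurable fun x => jumpTerm a b Φ G (η x) (ξ x) (u x) (u' x) := by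
  have hr := measurable_pair_remove a hu hξ
  exact ((hG.comp (measurable_pair_add b hu' hr)).sub (hG.comp hξ)).mul
    (hΦ.comp (hu.prodMk (hu'.prodMk (hr.prodMk (measurable_pair_diff hη hξ)))))

lemma measurable_jumpOp (hΦ : Measurable Φ) (hG : Measurable G) :
    Measurable (jumpOp a b Φ G) := by
  refine measurable_sumSub_real
    (f := fun η ξ => ∑ u ∈ ξ.pts a, ∫ u', jumpTerm a b Φ G η ξ u u') measurable_id ?_
  refine measurable_sum_pair_pts_real a (f := fun (q : ConfPair d × ConfPair d) u =>
    ∫ u', jumpTerm a b Φ G q.1 q.2 u u') measurable_snd ?_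
  refine (StronglyMeasurable.integral_prod_right'
    (f := fun q : ((ConfPair d × ConfPair d) × Site d) × Site d =>
      jumpTerm a b Φ G q.1.1.1 q.1.1.2 q.1.2 q.2) ?_).measurable
  exact (measurable_jumpTerm a b hΦ hG measurable_fst.fst.fst measurable_fst.fst.snd
    measurable_fst.snd measurable_snd).stronglyMeasurable

end measurability

/-- The sum of the integrals of the absolute values of the terms in `jumpOp`. -/
noncomputable def jumpAbs (a b : Bool) (Φ : JumpVars d → ℝ) (G : ConfPair d → ℝ)
    (η : ConfPair d) : ℝ≥0∞ :=
  sumSub η fun ξ => ∑ u ∈ ξ.pts a, ∫⁻ u', ‖jumpTerm a b Φ G η ξ u u'‖ₑ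

lemma enorm_jumpOp_le (a b : Bool) (Φ : JumpVars d → ℝ) (G : ConfPair d → ℝ) (η : ConfPair d) :
    ‖jumpOp a b Φ G η‖ₑ ≤ jumpAbs a b Φ G η :=
  (enorm_sumSub_le _ _).trans <| sumSub_mono fun _ => (enorm_sum_le _ _).trans <|
    Finset.sum_le_sum fun _ _ => enorm_integral_le_lintegral_enorm _

lemma measurable_jumpAbs (a b : Bool) {Φ : JumpVars d → ℝ} {G : ConfPair d → ℝ}
    (hΦ : Measurable Φ) (hG : Measurable G) : Measurable (jumpAbs a b Φ G) := by
  refine measurable_sumSub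
    (f := fun η ξ => ∑ u ∈ ξ.pts a, ∫⁻ u', ‖jumpTerm a b Φ G η ξ u u'‖ₑ) measurable_id ?_
  refine measurable_sum_pair_pts a (f := fun (q : ConfPair d × ConfPair d) u =>
    ∫⁻ u', ‖jumpTerm a b Φ G q.1 q.2 u u'‖ₑ) measurable_snd ?_
  refine Measurable.lintegral_prod_right'
    (f := fun q : ((ConfPair d × ConfPair d) × Site d) × Site d =>
      ‖jumpTerm a b Φ G q.1.1.1 q.1.1.2 q.1.2 q.2‖ₑ) ?_
  exact (measurable_jumpTerm a b hΦ hG measurable_fst.fst.fst measurable_fst.fst.snd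
    measurable_fst.snd measurable_snd).enorm

lemma jumpConverges_of_jumpAbs_lt_top (a b : Bool) {Φ : JumpVars d → ℝ} {G : ConfPair d → ℝ}
    (hΦ : Measurable Φ) (hG : Measurable G) {η : ConfPair d} (h : jumpAbs a b Φ G η < ∞) :
    JumpConverges a b Φ G η := by
  intro s hs t ht u hu
  refine ⟨(measurable_jumpTerm a b hΦ hG measurable_const measurable_const measurable_const
    measurable_id).aestronglyMeasurable, ?_⟩
  refine lt_of_le_of_lt ?_ h
  refine le_trans ?_ (le_sumSub (fun ξ => ∑ u ∈ ξ.pts a, ∫⁻ u', ‖jumpTerm a b Φ G η ξ u u'‖ₑ)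
    hs ht)
  exact Finset.single_le_sum
    (f := fun u => ∫⁻ u', ‖jumpTerm a b Φ G η (⟨s⟩, ⟨t⟩) u u'‖ₑ) (fun _ _ => zero_le) hu

lemma lintegral_jumpAbs_le (hd : 1 ≤ d) {z : ℝ} (hz : 0 ≤ z) (a b : Bool) {Φ : JumpVars d → ℝ}
    {G : ConfPair d → ℝ} (hΦ : Measurable Φ) (hG : Measurable G) :
    ∫⁻ η, jumpAbs a b Φ G η ∂(pairMeasure d z) ≤
      ∫⁻ ξ, ‖G ξ‖ₑ * (exitWeight z a (fun q => ‖Φ q‖ₑ) ξ +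
        exitWeight z b (reverseJump fun q => ‖Φ q‖ₑ) ξ) ∂(pairMeasure d z) := by
  have hΦe : Measurable fun q => ‖Φ q‖ₑ := hΦ.enorm
  have hGe : Measurable fun ξ => ‖G ξ‖ₑ := hG.enorm
  have hA : Measurable fun η : ConfPair d => sumSub η (fun ξ => ∑ u ∈ ξ.pts a, ∫⁻ u',
      ‖G ξ‖ₑ * ‖Φ (u, u', ξ.remove a u, η.diff ξ)‖ₑ) := by
    refine measurable_sumSub (f := fun η ξ => ∑ u ∈ ξ.pts a, ∫⁻ u',
      ‖G ξ‖ₑ * ‖Φ (u, u', ξ.remove a u, η.diff ξ)‖ₑ) measurable_id ?_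
    refine measurable_sum_pair_pts a (f := fun (q : ConfPair d × ConfPair d) u => ∫⁻ u',
      ‖G q.2‖ₑ * ‖Φ (u, u', q.2.remove a u, q.1.diff q.2)‖ₑ) measurable_snd ?_
    refine Measurable.lintegral_prod_right'
      (f := fun q : ((ConfPair d × ConfPair d) × Site d) × Site d => ‖G q.1.1.2‖ₑ *
        ‖Φ (q.1.2, q.2, q.1.1.2.remove a q.1.2, q.1.1.1.diff q.1.1.2)‖ₑ) ?_
    exact (hGe.comp measurable_fst.fst.snd).mul (hΦe.comp (measurable_fst.snd.prodMk
      (measurable_snd.prodMk ((measurable_pair_remove a measurable_fst.snd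
        measurable_fst.fst.snd).prodMk
          (measurable_pair_diff measurable_fst.fst.fst measurable_fst.fst.snd)))))
  have hW : Measurable fun ξ => ‖G ξ‖ₑ * exitWeight z a (fun q => ‖Φ q‖ₑ) ξ :=
    hGe.mul (measurable_exitWeight a hΦe)
  simp_rw [mul_add]
  rw [lintegral_add_left hW,
    ← lintegral_stay hd hz a hΦe hGe, ← lintegral_arrive hd hz a b hΦe hGe,
    ← lintegral_add_left hA]
  refine lintegral_mono fun η => ?_
  rw [← sumSub_add]
  refine sumSub_mono fun ξ => ?_
  rw [← Finset.sum_add_distrib]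
  refine Finset.sum_le_sum fun u _ => ?_
  rw [← lintegral_add_left]
  · refine lintegral_mono fun u' => ?_
    rw [jumpTerm, enorm_mul, ← add_mul, add_comm]
    exact mul_le_mul_left (enorm_sub_le) _
  · exact (hΦe.comp (measurable_const.prodMk (measurable_id.prodMk measurable_const))).const_mul _

/-- A jump could move `ξ` into the null set where `G` and `G'` differ. The formulas for staying and
arriving, with constant kernel and the indicator of this set, show that this happens only for a
negligible set of jumps. -/
lemma ae_jumpTerm_congr (hd : 1 ≤ d) {z : ℝ} (hz : 0 ≤ z) (a b : Bool) (Φ : JumpVars d → ℝ)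
    {G G' : ConfPair d → ℝ} (h : G =ᵐ[pairMeasure d z] G') :
    ∀ᵐ η ∂(pairMeasure d z), ∀ s ⊆ η.1.pts, ∀ t ⊆ η.2.pts, ∀ u ∈ ConfPair.pts a (⟨s⟩, ⟨t⟩),
      jumpTerm a b Φ G η (⟨s⟩, ⟨t⟩) u =ᵐ[volume] jumpTerm a b Φ G' η (⟨s⟩, ⟨t⟩) u := by
  set A := toMeasurable (pairMeasure d z) {ξ | G ξ = G' ξ}ᶜ with hA
  have hA0 : pairMeasure d z A = 0 := by
    rw [hA, measure_toMeasurable]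
    exact h
  have hAm : MeasurableSet A := measurableSet_toMeasurable _ _
  let I : ConfPair d → ℝ≥0∞ := A.indicator 1
  have hI : Measurable I := measurable_one.indicator hAm
  -- The exit weight of the constant kernel may be infinite; this is harmless since `0 * ∞ = 0`.
  have hI0 : ∀ W : ConfPair d → ℝ≥0∞, ∫⁻ ξ, I ξ * W ξ ∂(pairMeasure d z) = 0 := fun W => by
    have : (fun ξ => I ξ * W ξ) =ᵐ[pairMeasure d z] fun _ => 0 := by
      filter_upwards [compl_mem_ae_iff.2 hA0] with ξ hξ
      simp [I, show ξ ∉ A from hξ]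
    rw [lintegral_congr_ae this, lintegral_zero]
  have hIeq : ∀ ξ, I ξ = 0 → G ξ = G' ξ := fun ξ hξ => by
    by_contra hne
    have : ξ ∈ A := subset_toMeasurable _ _ hne
    simp [I, this] at hξ
  have h1 := lintegral_stay hd hz a (Φ := fun _ => 1) measurable_const hI
  have h2 := lintegral_arrive hd hz a b (Φ := fun _ => 1) measurable_const hI
  rw [hI0] at h1 h2
  simp only [mul_one] at h1 h2
  have hm1 : Measurable fun η : ConfPair d => sumSub η (fun ξ => ∑ u ∈ ξ.pts a, ∫⁻ _ : Site d,
      I ξ) := by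
    refine measurable_sumSub (f := fun _ ξ => ∑ u ∈ ξ.pts a, ∫⁻ _ : Site d, I ξ)
      measurable_id ?_
    refine measurable_sum_pair_pts a (f := fun (q : ConfPair d × ConfPair d) _ =>
      ∫⁻ _ : Site d, I q.2) measurable_snd ?_
    exact Measurable.lintegral_prod_right'
      (f := fun q : ((ConfPair d × ConfPair d) × Site d) × Site d => I q.1.1.2)
      (hI.comp measurable_fst.fst.snd)
  have hm2 : Measurable fun η : ConfPair d => sumSub η (fun ξ => ∑ u ∈ ξ.pts a, ∫⁻ u' : Site d,
      I ((ξ.remove a u).add b u')) := by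
    refine measurable_sumSub (f := fun _ ξ => ∑ u ∈ ξ.pts a, ∫⁻ u' : Site d,
      I ((ξ.remove a u).add b u')) measurable_id ?_
    refine measurable_sum_pair_pts a (f := fun (q : ConfPair d × ConfPair d) u =>
      ∫⁻ u' : Site d, I ((q.2.remove a u).add b u')) measurable_snd ?_
    exact Measurable.lintegral_prod_right'
      (f := fun q : ((ConfPair d × ConfPair d) × Site d) × Site d =>
        I ((q.1.1.2.remove a q.1.2).add b q.2))
      (hI.comp (measurable_pair_add b measurable_snd
        (measurable_pair_remove a measurable_fst.snd measurable_fst.fst.snd)))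
  have key : ∀ (f : ConfPair d → Site d → Site d → ℝ≥0∞) (η : ConfPair d),
      sumSub η (fun ξ => ∑ u ∈ ξ.pts a, ∫⁻ u', f ξ u u') = 0 →
      ∀ s ⊆ η.1.pts, ∀ t ⊆ η.2.pts, ∀ u ∈ ConfPair.pts a (⟨s⟩, ⟨t⟩),
        ∫⁻ u', f (⟨s⟩, ⟨t⟩) u u' = 0 := by
    intro f η h s hs t ht u hu
    have h' := le_antisymm ((le_sumSub (fun ξ => ∑ u ∈ ξ.pts a, ∫⁻ u', f ξ u u') hs ht).trans
      h.le) zero_le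
    exact Finset.sum_eq_zero_iff.1 h' u hu
  filter_upwards [(lintegral_eq_zero_iff hm1).1 h1, (lintegral_eq_zero_iff hm2).1 h2]
    with η e1 e2 s hs t ht u hu
  have i1 := key (fun ξ _ _ => I ξ) η e1 s hs t ht u hu
  have i2 := key (fun ξ u u' => I ((ξ.remove a u).add b u')) η e2 s hs t ht u hu
  have m2 : Measurable fun u' => I (ConfPair.add b u' (ConfPair.remove a u (⟨s⟩, ⟨t⟩))) :=
    hI.comp (measurable_pair_add b measurable_id measurable_const)
  filter_upwards [(lintegral_eq_zero_iff measurable_const).1 i1, (lintegral_eq_zero_iff m2).1 i2]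
    with u' j1 j2
  rw [jumpTerm, jumpTerm, hIeq _ j1, hIeq _ j2]

lemma JumpConverges.congr {a b : Bool} {Φ : JumpVars d → ℝ} {G G' : ConfPair d → ℝ}
    {η : ConfPair d} (h : ∀ s ⊆ η.1.pts, ∀ t ⊆ η.2.pts, ∀ u ∈ ConfPair.pts a (⟨s⟩, ⟨t⟩),
      jumpTerm a b Φ G η (⟨s⟩, ⟨t⟩) u =ᵐ[volume] jumpTerm a b Φ G' η (⟨s⟩, ⟨t⟩) u)
    (hG : JumpConverges a b Φ G η) : JumpConverges a b Φ G' η :=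
  fun s hs t ht u hu => (hG s hs t ht u hu).congr (h s hs t ht u hu)

lemma jumpOp_congr {a b : Bool} {Φ : JumpVars d → ℝ} {G G' : ConfPair d → ℝ}
    {η : ConfPair d} (h : ∀ s ⊆ η.1.pts, ∀ t ⊆ η.2.pts, ∀ u ∈ ConfPair.pts a (⟨s⟩, ⟨t⟩),
      jumpTerm a b Φ G η (⟨s⟩, ⟨t⟩) u =ᵐ[volume] jumpTerm a b Φ G' η (⟨s⟩, ⟨t⟩) u) :
    jumpOp a b Φ G η = jumpOp a b Φ G' η :=
  sumSub_congr fun s hs t ht => Finset.sum_congr rfl fun u hu =>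
    integral_congr_ae (h s hs t ht u hu)

lemma jumpOp_add {a b : Bool} {Φ : JumpVars d → ℝ} {G G' : ConfPair d → ℝ} {η : ConfPair d}
    (hG : JumpConverges a b Φ G η) (hG' : JumpConverges a b Φ G' η) :
    jumpOp a b Φ (G + G') η = jumpOp a b Φ G η + jumpOp a b Φ G' η := by
  unfold jumpOp
  rw [← sumSub_add]
  refine sumSub_congr fun s hs t ht => ?_
  rw [← Finset.sum_add_distrib]
  refine Finset.sum_congr rfl fun u hu => ?_
  rw [← integral_add (hG s hs t ht u hu) (hG' s hs t ht u hu)]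
  refine integral_congr_ae (Filter.Eventually.of_forall fun u' => ?_)
  simp only [jumpTerm, Pi.add_apply]
  ring

/-- Unlike additivity, this needs no convergence: a divergent integral has the default value `0`,
which is compatible with scaling. -/
lemma jumpOp_smul (a b : Bool) (Φ : JumpVars d → ℝ) (c : ℝ) (G : ConfPair d → ℝ)
    (η : ConfPair d) : jumpOp a b Φ (c • G) η = c * jumpOp a b Φ G η := by
  simp only [jumpOp, sumSub, Finset.mul_sum]
  refine Finset.sum_congr rfl fun s _ => Finset.sum_congr rfl fun t _ =>
    Finset.sum_congr rfl fun u _ => ?_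
  rw [← integral_const_mul]
  refine integral_congr_ae (Filter.Eventually.of_forall fun u' => ?_)
  simp only [jumpTerm, Pi.smul_apply, smul_eq_mul]
  ring

end jumpOperators

/-! ### Disjoint pairs -/

section disjointPairs

open scoped Classical

variable {d : ℕ}

lemma map_val_lebesguePoisson2 (hd : 1 ≤ d) {z : ℝ} (hz : 0 ≤ z) :
    Measure.map Subtype.val (lebesguePoisson2 d z) = pairMeasure d z := by
  have h := (MeasurableEmbedding.subtype_coe (measurableSet_conf_disjoint (d := d))).map_comap
    (pairMeasure d z)
  refine Eq.trans h ?_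
  rw [Subtype.range_coe]
  exact Measure.restrict_eq_self_of_ae_mem (ae_disjoint_lebesguePoisson hd hz)

lemma ae_lebesguePoisson2_iff (hd : 1 ≤ d) {z : ℝ} (hz : 0 ≤ z) {p : ConfPair d → Prop} :
    (∀ᵐ η ∂(lebesguePoisson2 d z), p η.1) ↔ ∀ᵐ η ∂(pairMeasure d z), p η := by
  rw [← map_val_lebesguePoisson2 hd hz]
  exact (MeasurableEmbedding.subtype_coe measurableSet_conf_disjoint).ae_map_iff.symm

lemma lintegral_lebesguePoisson2 (hd : 1 ≤ d) {z : ℝ} (hz : 0 ≤ z) (f : ConfPair d → ℝ≥0∞) :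
    ∫⁻ η, f η.1 ∂(lebesguePoisson2 d z) = ∫⁻ η, f η ∂(pairMeasure d z) := by
  rw [← map_val_lebesguePoisson2 hd hz]
  exact ((MeasurableEmbedding.subtype_coe measurableSet_conf_disjoint).lintegral_map f).symm

/-- All weights `w ^ n / n!` are positive, so a null set of `λ_w` is null for each `m⁽ⁿ⁾`.
Statements that hold almost everywhere for `λ²` thus pass to `λ_C²` and back. -/
lemma lebesguePoisson_absolutelyContinuous {z w : ℝ} (hw : 0 < w) :
    lebesguePoisson d z ≪ lebesguePoisson d w := by
  refine Measure.AbsolutelyContinuous.mk fun s hs h => ?_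
  simp only [lebesguePoisson, Measure.sum_apply _ hs, ENNReal.tsum_eq_zero, Measure.smul_apply,
    smul_eq_mul, mul_eq_zero] at h ⊢
  refine fun n => Or.inr ((h n).resolve_left ?_)
  rw [ENNReal.ofReal_eq_zero, not_le]
  positivity

lemma lebesguePoisson2_absolutelyContinuous (hd : 1 ≤ d) {z w : ℝ} (hz : 0 ≤ z) (hw : 0 < w) :
    lebesguePoisson2 d z ≪ lebesguePoisson2 d w := by
  have h : pairMeasure d z ≪ pairMeasure d w :=
    (lebesguePoisson_absolutelyContinuous hw).prod (lebesguePoisson_absolutelyContinuous hw)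
  have he := MeasurableEmbedding.subtype_coe (measurableSet_conf_disjoint (d := d))
  intro s hs
  have hs' : pairMeasure d w (Subtype.val '' s) = 0 := by
    rw [← map_val_lebesguePoisson2 hd hw.le]
    refine (he.map_apply _ _).trans ?_
    exact (congrArg _ (preimage_image_eq s Subtype.val_injective)).trans hs
  have := h hs'
  rw [← map_val_lebesguePoisson2 hd hz] at this
  have := (he.map_apply _ _).symm.trans this
  exact (congrArg _ (preimage_image_eq s Subtype.val_injective)).symm.trans this

/-- The extension by zero of a function on `Γ₀²` to all pairs of configurations. -/
noncomputable def evalPair (g : FinConf2 d → ℝ) (p : ConfPair d) : ℝ :=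
  evalAt g p.1.pts p.2.pts

@[simp]
lemma evalPair_val (g : FinConf2 d → ℝ) (η : FinConf2 d) : evalPair g η.1 = g η := by
  rw [evalPair, evalAt, dif_pos η.2]

lemma measurable_evalPair {α : Type*} [MeasurableSpace α] {g : α → FinConf2 d → ℝ}
    (hg : Measurable (Function.uncurry g)) :
    Measurable fun q : α × ConfPair d => evalPair (g q.1) q.2 := by
  have hs : MeasurableSet {q : α × ConfPair d | Disjoint q.2.1.pts q.2.2.pts} :=
    measurable_snd measurableSet_conf_disjoint
  refine measurable_of_restrict_of_restrict_compl hs ?_ ?_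
  · have : {q : α × ConfPair d | Disjoint q.2.1.pts q.2.2.pts}.domRestrict
        (fun q => evalPair (g q.1) q.2) = fun q => g q.1.1 ⟨q.1.2, q.2⟩ := by
      funext q
      exact evalPair_val (g q.1.1) ⟨q.1.2, q.2⟩
    rw [this]
    exact hg.comp (measurable_subtype_coe.fst.prodMk (measurable_subtype_coe.snd.subtype_mk))
  · have : {q : α × ConfPair d | Disjoint q.2.1.pts q.2.2.pts}ᶜ.domRestrict
        (fun q => evalPair (g q.1) q.2) = fun _ => 0 := by
      funext q
      exact dif_neg q.2
    rw [this]
    exact measurable_const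

lemma measurable_evalPair_single {g : FinConf2 d → ℝ} (hg : Measurable g) :
    Measurable (evalPair g) :=
  (measurable_evalPair (α := Unit) (g := fun _ => g) (hg.comp measurable_snd)).comp
    (measurable_const.prodMk measurable_id : Measurable fun p : ConfPair d => ((), p))

lemma evalPair_congr_ae (hd : 1 ≤ d) {z : ℝ} (hz : 0 ≤ z) {g g' : FinConf2 d → ℝ}
    (h : g =ᵐ[lebesguePoisson2 d z] g') : evalPair g =ᵐ[pairMeasure d z] evalPair g' := by
  refine (ae_lebesguePoisson2_iff hd hz (p := fun p => evalPair g p = evalPair g' p)).1 ?_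
  filter_upwards [h] with η hη
  rw [evalPair_val, evalPair_val, hη]

lemma evalPair_add (g g' : FinConf2 d → ℝ) : evalPair (g + g') = evalPair g + evalPair g' := by
  funext p
  simp only [evalPair, evalAt, Pi.add_apply]
  split_ifs <;> simp

lemma evalPair_smul (c : ℝ) (g : FinConf2 d → ℝ) : evalPair (c • g) = c • evalPair g := by
  funext p
  simp only [evalPair, evalAt, Pi.smul_apply, smul_eq_mul]
  split_ifs <;> simp

/-- The function `C(x, y, ξ, ζ)` of a hopping rate `c`, as a jump kernel. -/
noncomputable def rateKernel (c : Site d → Site d → FinConf2 d → ℝ) : JumpVars d → ℝ :=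
  fun q => rateK c q.1 q.2.1 q.2.2.1.1.pts q.2.2.1.2.pts q.2.2.2.1.pts q.2.2.2.2.pts

lemma measurable_rateKernel {c : Site d → Site d → FinConf2 d → ℝ}
    (hc : Measurable fun p : Site d × Site d × FinConf2 d => c p.1 p.2.1 p.2.2) :
    Measurable (rateKernel c) := by
  have hc' : Measurable (Function.uncurry fun q : Site d × Site d => c q.1 q.2) :=
    hc.comp (measurable_fst.fst.prodMk (measurable_fst.snd.prodMk measurable_snd))
  have he := measurable_evalPair hc'
  let f : JumpVars d → ConfPair d → ℝ := fun q ω =>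
    (-1 : ℝ) ^ ((q.2.2.2.diff ω).1.pts.card + (q.2.2.2.diff ω).2.pts.card) *
      evalPair (c q.1 q.2.1) (⟨ω.1.pts ∪ q.2.2.1.1.pts⟩, ⟨ω.2.pts ∪ q.2.2.1.2.pts⟩)
  have hf : Measurable (Function.uncurry f) := by
    have hdiff : Measurable fun q : JumpVars d × ConfPair d => q.1.2.2.2.diff q.2 :=
      measurable_pair_diff measurable_fst.snd.snd.snd measurable_snd
    refine Measurable.mul ?_ ?_
    · exact (measurable_from_top (f := fun n : ℕ => (-1 : ℝ) ^ n)).comp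
        ((measurable_conf_card hdiff.fst).add (measurable_conf_card hdiff.snd))
    · refine he.comp ((measurable_fst.fst.prodMk measurable_fst.snd.fst).prodMk
        ((measurable_conf_union measurable_snd.fst measurable_fst.snd.snd.fst.fst).prodMk
          (measurable_conf_union measurable_snd.snd measurable_fst.snd.snd.fst.snd)))
  have hsum : rateKernel c = fun q => sumSub q.2.2.2 (f q) := by
    funext q
    simp only [rateKernel, rateK, invKShift, sumSub]
    rfl
  rw [hsum]
  exact measurable_sumSub_real measurable_snd.snd.snd hf

lemma normIntSnd_eq (hd : 1 ≤ d) {C : ℝ} (hC : 0 ≤ C) (c : Site d → Site d → FinConf2 d → ℝ)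
    (x : Site d) (ξ : ConfPair d) :
    normIntSnd C c x ξ.1.pts ξ.2.pts =
      ∫⁻ ζ, ∫⁻ y, ‖rateKernel c (x, y, ξ, ζ)‖ₑ ∂volume ∂(pairMeasure d C) := by
  rw [normIntSnd, eLpNorm_one_eq_lintegral_enorm, ← lintegral_lebesguePoisson2 hd hC]
  rfl

lemma normIntFst_eq (hd : 1 ≤ d) {C : ℝ} (hC : 0 ≤ C) (c : Site d → Site d → FinConf2 d → ℝ)
    (y : Site d) (ξ : ConfPair d) :
    normIntFst C c y ξ.1.pts ξ.2.pts =
      ∫⁻ ζ, ∫⁻ x, ‖rateKernel c (x, y, ξ, ζ)‖ₑ ∂volume ∂(pairMeasure d C) := by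
  rw [normIntFst, eLpNorm_one_eq_lintegral_enorm, ← lintegral_lebesguePoisson2 hd hC]
  rfl

/-- The sum of two jump operators, with jumps from `+` to `b₁` and from `-` to `b₂`, as an
operator in `𝓛_C`. -/
theorem exists_jumpOperator (hd : 1 ≤ d) {C : ℝ} (hC : 0 < C) (b₁ b₂ : Bool)
    {Φ₁ Φ₂ : JumpVars d → ℝ} (hΦ₁ : Measurable Φ₁) (hΦ₂ : Measurable Φ₂) {N : FinConf2 d → ℝ}
    (hN : AEMeasurable N (lebesguePoisson2 d 1))
    (hb : ∀ᵐ η ∂(lebesguePoisson2 d 1),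
      (exitWeight C true (fun q => ‖Φ₁ q‖ₑ) η.1 +
        exitWeight C b₁ (reverseJump fun q => ‖Φ₁ q‖ₑ) η.1) +
      (exitWeight C false (fun q => ‖Φ₂ q‖ₑ) η.1 +
        exitWeight C b₂ (reverseJump fun q => ‖Φ₂ q‖ₑ) η.1) ≤ ENNReal.ofReal (N η)) :
    ∃ L : LSpace d C →ₗ.[ℝ] LSpace d C, IsDenselyDefinedOn L N ∧
      ∀ (G : L.domain) (g : FinConf2 d → ℝ), g =ᵐ[lebesguePoisson2 d 1] (G : LSpace d C) →
        (∀ᵐ η ∂(lebesguePoisson2 d 1), JumpConverges true b₁ Φ₁ (evalPair g) η.1 ∧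
          JumpConverges false b₂ Φ₂ (evalPair g) η.1) ∧
        (L G : FinConf2 d → ℝ) =ᵐ[lebesguePoisson2 d 1] (fun η =>
          jumpOp true b₁ Φ₁ (evalPair g) η.1 + jumpOp false b₂ Φ₂ (evalPair g) η.1) ∧
        ‖L G‖ ≤ ∫ η, |N η * g η| ∂(lebesguePoisson2 d C) := by
  have h1C := lebesguePoisson2_absolutelyContinuous hd (zero_le_one (α := ℝ)) hC
  have hC1 := lebesguePoisson2_absolutelyContinuous hd hC.le (zero_lt_one (α := ℝ))
  have hle : ∀ g : FinConf2 d → ℝ, Measurable g →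
      ∫⁻ η : FinConf2 d, (jumpAbs true b₁ Φ₁ (evalPair g) η.1 +
        jumpAbs false b₂ Φ₂ (evalPair g) η.1) ∂(lebesguePoisson2 d C) ≤
      ∫⁻ η, ‖N η * g η‖ₑ ∂(lebesguePoisson2 d C) := by
    intro g hg
    have hgm := measurable_evalPair_single hg
    have hWm : ∀ (a b : Bool) {Φ : JumpVars d → ℝ}, Measurable Φ → Measurable fun ξ =>
        ‖evalPair g ξ‖ₑ * (exitWeight C a (fun q => ‖Φ q‖ₑ) ξ +
          exitWeight C b (reverseJump fun q => ‖Φ q‖ₑ) ξ) := fun a b Φ hΦ =>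
      hgm.enorm.mul ((measurable_exitWeight a hΦ.enorm).add
        (measurable_exitWeight b hΦ.enorm.reverseJump))
    calc _ = ∫⁻ η, (jumpAbs true b₁ Φ₁ (evalPair g) η + jumpAbs false b₂ Φ₂ (evalPair g) η)
          ∂(pairMeasure d C) := lintegral_lebesguePoisson2 hd hC.le _
      _ = ∫⁻ η, jumpAbs true b₁ Φ₁ (evalPair g) η ∂(pairMeasure d C) +
          ∫⁻ η, jumpAbs false b₂ Φ₂ (evalPair g) η ∂(pairMeasure d C) :=
        lintegral_add_left (measurable_jumpAbs true b₁ hΦ₁ hgm) _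
      _ ≤ _ := add_le_add (lintegral_jumpAbs_le hd hC.le true b₁ hΦ₁ hgm)
        (lintegral_jumpAbs_le hd hC.le false b₂ hΦ₂ hgm)
      _ = _ := (lintegral_add_left (hWm true b₁ hΦ₁) _).symm
      _ = _ := (lintegral_lebesguePoisson2 hd hC.le _).symm
      _ ≤ _ := by
        refine lintegral_mono_ae ?_
        filter_upwards [hC1.ae_le hb] with η hη
        rw [evalPair_val, ← mul_add, enorm_mul, mul_comm]
        -- No sign condition on `N` is required, because its positive part is at most its absolute
        -- value.
        exact mul_le_mul_left (hη.trans (Real.ofReal_le_enorm _)) _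
  obtain ⟨L, hL, hLG⟩ := exists_linearPMap_of_le_mul (μ := lebesguePoisson2 d C)
    (hN.mono_ac hC1)
    (fun g η => jumpOp true b₁ Φ₁ (evalPair g) η.1 + jumpOp false b₂ Φ₂ (evalPair g) η.1)
    (fun g η => JumpConverges true b₁ Φ₁ (evalPair g) η.1 ∧
      JumpConverges false b₂ Φ₂ (evalPair g) η.1)
    (fun g g' h => by
      have h' := evalPair_congr_ae hd hC.le h
      filter_upwards [(ae_lebesguePoisson2_iff hd hC.le).2
          (ae_jumpTerm_congr hd hC.le true b₁ Φ₁ h'),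
        (ae_lebesguePoisson2_iff hd hC.le).2 (ae_jumpTerm_congr hd hC.le false b₂ Φ₂ h')]
        with η h1 h2
      exact ⟨fun hc => ⟨hc.1.congr h1, hc.2.congr h2⟩,
        congrArg₂ _ (jumpOp_congr h1) (jumpOp_congr h2)⟩)
    (fun g hg => ((measurable_jumpOp true b₁ hΦ₁ (measurable_evalPair_single hg)).add
      (measurable_jumpOp false b₂ hΦ₂ (measurable_evalPair_single hg))).comp
        measurable_subtype_coe)
    (fun g hg => (lintegral_mono fun η => (enorm_add_le _ _).trans
      (add_le_add (enorm_jumpOp_le _ _ _ _ _) (enorm_jumpOp_le _ _ _ _ _))).trans (hle g hg))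
    (fun g hg hfin => by
      have hgm := measurable_evalPair_single hg
      have hm : Measurable fun η : FinConf2 d => jumpAbs true b₁ Φ₁ (evalPair g) η.1 +
          jumpAbs false b₂ Φ₂ (evalPair g) η.1 :=
        ((measurable_jumpAbs true b₁ hΦ₁ hgm).add
          (measurable_jumpAbs false b₂ hΦ₂ hgm)).comp measurable_subtype_coe
      filter_upwards [ae_lt_top hm ((hle g hg).trans_lt hfin).ne] with η hη
      have := ENNReal.add_lt_top.1 hη
      exact ⟨jumpConverges_of_jumpAbs_lt_top _ _ hΦ₁ hgm this.1,
        jumpConverges_of_jumpAbs_lt_top _ _ hΦ₂ hgm this.2⟩)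
    (fun g g' η h h' => by
      simp only [evalPair_add, jumpOp_add h.1 h'.1, jumpOp_add h.2 h'.2]
      ring)
    (fun c g η => by
      simp only [evalPair_smul, jumpOp_smul]
      ring)
  refine ⟨L, hL, fun G g hg => ?_⟩
  obtain ⟨h1, h2, h3⟩ := hLG G g (hC1.ae_le hg)
  exact ⟨h1C.ae_le h1, h1C.ae_le h2, h3⟩

lemma hopSumConverges_of_jumpConverges {b₁ b₂ : Bool} {Φ₁ Φ₂ : JumpVars d → ℝ}
    {g : FinConf2 d → ℝ}
    {tp tm : FinConf2 d → Finset (Site d) → Finset (Site d) → Site d → Site d → ℝ}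
    (hp : ∀ η s t, tp η s t = jumpTerm true b₁ Φ₁ (evalPair g) η.1 (⟨s⟩, ⟨t⟩))
    (hm : ∀ η s t, tm η s t = jumpTerm false b₂ Φ₂ (evalPair g) η.1 (⟨s⟩, ⟨t⟩))
    {η : FinConf2 d} (h : JumpConverges true b₁ Φ₁ (evalPair g) η.1 ∧
      JumpConverges false b₂ Φ₂ (evalPair g) η.1) : HopSumConverges tp tm η := by
  intro s hs t ht
  rw [hp, hm]
  exact ⟨h.1 s hs t ht, h.2 s hs t ht⟩

lemma hopSum_eq_jumpOp {b₁ b₂ : Bool} {Φ₁ Φ₂ : JumpVars d → ℝ} {g : FinConf2 d → ℝ}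
    {tp tm : FinConf2 d → Finset (Site d) → Finset (Site d) → Site d → Site d → ℝ}
    (hp : ∀ η s t, tp η s t = jumpTerm true b₁ Φ₁ (evalPair g) η.1 (⟨s⟩, ⟨t⟩))
    (hm : ∀ η s t, tm η s t = jumpTerm false b₂ Φ₂ (evalPair g) η.1 (⟨s⟩, ⟨t⟩)) :
    hopSum tp tm = fun η : FinConf2 d =>
      jumpOp true b₁ Φ₁ (evalPair g) η.1 + jumpOp false b₂ Φ₂ (evalPair g) η.1 := by
  funext η
  simp only [hopSum, hp, hm]
  rfl

lemma term1p_eq_jumpTerm (c : Site d → Site d → FinConf2 d → ℝ) (g : FinConf2 d → ℝ)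
    (η : FinConf2 d) (s t : Finset (Site d)) : term1p c g η s t =
      jumpTerm true true (rateKernel c) (evalPair g) η.1 (⟨s⟩, ⟨t⟩) := by
  funext u u'
  rfl

lemma term1m_eq_jumpTerm (c : Site d → Site d → FinConf2 d → ℝ) (g : FinConf2 d → ℝ)
    (η : FinConf2 d) (s t : Finset (Site d)) : term1m c g η s t =
      jumpTerm false false (rateKernel c) (evalPair g) η.1 (⟨s⟩, ⟨t⟩) := by
  funext u u'
  rfl

lemma term2p_eq_jumpTerm (c : Site d → Site d → FinConf2 d → ℝ) (g : FinConf2 d → ℝ)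
    (η : FinConf2 d) (s t : Finset (Site d)) : term2p c g η s t =
      jumpTerm true false (rateKernel c) (evalPair g) η.1 (⟨s⟩, ⟨t⟩) := by
  funext u u'
  rfl

/-- The rate `c₂⁻` takes the site of the `+` particle first, but the jump starts at the `-`
particle, hence the reversed kernel. -/
lemma term2m_eq_jumpTerm (c : Site d → Site d → FinConf2 d → ℝ) (g : FinConf2 d → ℝ)
    (η : FinConf2 d) (s t : Finset (Site d)) : term2m c g η s t =
      jumpTerm false true (reverseJump (rateKernel c)) (evalPair g) η.1 (⟨s⟩, ⟨t⟩) := by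
  funext u u'
  rfl

end disjointPairs

/-! ### The two hopping operators. -/

theorem mainTheorem7 (d : ℕ) (hd : 1 ≤ d) (C : ℝ) (hC : 0 < C)
    (c₁p c₁m c₂p c₂m : Site d → Site d → FinConf2 d → ℝ)
    (hc₁p : IsHoppingRate c₁p) (hc₁m : IsHoppingRate c₁m)
    (hc₂p : IsHoppingRate c₂p) (hc₂m : IsHoppingRate c₂m)
    (N₁ N₂ : FinConf2 d → ℝ)
    (hN₁m : AEMeasurable N₁ (lebesguePoisson2 d 1))
    (hN₂m : AEMeasurable N₂ (lebesguePoisson2 d 1))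
    (hN₁ : LocallyFiniteIntegral N₁) (hN₂ : LocallyFiniteIntegral N₂)
    (hb₁ : RateBound1 C c₁p c₁m N₁) (hb₂ : RateBound2 C c₂p c₂m N₂) :
    (∃ L₁ : LSpace d C →ₗ.[ℝ] LSpace d C, IsDenselyDefinedOn L₁ N₁ ∧
      ∀ (G : L₁.domain) (g : FinConf2 d → ℝ), g =ᵐ[lebesguePoisson2 d 1] (G : LSpace d C) →
        (∀ᵐ η ∂(lebesguePoisson2 d 1), HopSumConverges (term1p c₁p g) (term1m c₁m g) η) ∧
        (L₁ G : FinConf2 d → ℝ) =ᵐ[lebesguePoisson2 d 1]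
          hopSum (term1p c₁p g) (term1m c₁m g) ∧
        ‖L₁ G‖ ≤ ∫ η, |N₁ η * g η| ∂(lebesguePoisson2 d C)) ∧
    (∃ L₂ : LSpace d C →ₗ.[ℝ] LSpace d C, IsDenselyDefinedOn L₂ N₂ ∧
      ∀ (G : L₂.domain) (g : FinConf2 d → ℝ), g =ᵐ[lebesguePoisson2 d 1] (G : LSpace d C) →
        (∀ᵐ η ∂(lebesguePoisson2 d 1), HopSumConverges (term2p c₂p g) (term2m c₂m g) η) ∧
        (L₂ G : FinConf2 d → ℝ) =ᵐ[lebesguePoisson2 d 1]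
          hopSum (term2p c₂p g) (term2m c₂m g) ∧
        ‖L₂ G‖ ≤ ∫ η, |N₂ η * g η| ∂(lebesguePoisson2 d C)) := by
  have hnS := fun (c : Site d → Site d → FinConf2 d → ℝ) x (ξ : ConfPair d) =>
    normIntSnd_eq hd hC.le c x ξ
  have hnF := fun (c : Site d → Site d → FinConf2 d → ℝ) x (ξ : ConfPair d) =>
    normIntFst_eq hd hC.le c x ξ
  constructor
  · obtain ⟨L, hL, h⟩ := exists_jumpOperator hd hC true false
      (measurable_rateKernel hc₁p.measurable) (measurable_rateKernel hc₁m.measurable) hN₁m (by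
        filter_upwards [hb₁] with η hη
        refine le_trans (le_of_eq ?_) hη
        simp only [exitWeight, ← Finset.sum_add_distrib]
        congr 1
        · refine Finset.sum_congr rfl fun x _ => ?_
          exact congrArg₂ _ (hnS c₁p x (ConfPair.remove true x η.1)).symm
            (hnF c₁p x (ConfPair.remove true x η.1)).symm
        · refine Finset.sum_congr rfl fun y _ => ?_
          rw [add_comm]
          exact congrArg₂ _ (hnF c₁m y (ConfPair.remove false y η.1)).symm
            (hnS c₁m y (ConfPair.remove false y η.1)).symm)
    refine ⟨L, hL, fun G g hg => ?_⟩
    obtain ⟨h1, h2, h3⟩ := h G g hg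
    refine ⟨h1.mono fun η hη => hopSumConverges_of_jumpConverges (term1p_eq_jumpTerm c₁p g)
      (term1m_eq_jumpTerm c₁m g) hη, ?_, h3⟩
    rwa [hopSum_eq_jumpOp (term1p_eq_jumpTerm c₁p g) (term1m_eq_jumpTerm c₁m g)]
  · obtain ⟨L, hL, h⟩ := exists_jumpOperator hd hC false true
      (measurable_rateKernel hc₂p.measurable)
      (measurable_rateKernel hc₂m.measurable).reverseJump hN₂m (by
        filter_upwards [hb₂] with η hη
        refine le_trans (le_of_eq ?_) hη
        -- The jump operators group the weights by jump, the assumed bound by the mark of the point: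
        -- a `+` point collects departures under `c₂⁺` and arrivals under `c₂⁻`, a `-` point the
        -- opposite.
        have e : ∀ a b c d : ℝ≥0∞, (a + b) + (c + d) = (a + d) + (b + c) := fun a b c d => by ring
        rw [e]
        simp only [exitWeight, ← Finset.sum_add_distrib]
        congr 1
        · refine Finset.sum_congr rfl fun x _ => ?_
          exact congrArg₂ _ (hnS c₂p x (ConfPair.remove true x η.1)).symm
            (hnS c₂m x (ConfPair.remove true x η.1)).symm
        · refine Finset.sum_congr rfl fun y _ => ?_
          exact congrArg₂ _ (hnF c₂p y (ConfPair.remove false y η.1)).symm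
            (hnF c₂m y (ConfPair.remove false y η.1)).symm)
    refine ⟨L, hL, fun G g hg => ?_⟩
    obtain ⟨h1, h2, h3⟩ := h G g hg
    refine ⟨h1.mono fun η hη => hopSumConverges_of_jumpConverges (term2p_eq_jumpTerm c₂p g)
      (term2m_eq_jumpTerm c₂m g) hη, ?_, h3⟩
    rwa [hopSum_eq_jumpOp (term2p_eq_jumpTerm c₂p g) (term2m_eq_jumpTerm c₂m g)]
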